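/- Let $N\ge 1$. The Schreier families are defined by $\mathcal S_0=\{\emptyset\}\cup\{\{n\}: n\ge1\}$ and $\mathcal S_{M+1}=\{\emptyset\}\cup\{E_1\cup\dots\cup E_k:\ k\ge 1,\ \emptyset\ne E_i\in\mathcal S_M,\ E_1<\dots<E_k,\ k\le\min E_1\}$ (finite subsets of $\{1,2,\dots\}$), and the Schreier space $X=X[\mathcal S_N]$ is the completion of the space $c_{00}$ of finitely supported (real or complex) sequences $(x_n)_{n\ge1}$ in the norm $\|x\|=\sup_{F\in\mathcal S_N}\sum_{n\in F}|x_n|$. Let $(\tilde e_n)$ be the unit vector basis of $X$, and for $J\subset\{1,2,\dots\}$ let $P_J$ be the canonical projection of $X$ onto the closed span of $\{\tilde e_n:n\in J\}$. An operator ideal on $X$ is a linear subspace of the algebra $\mathscr B(X)$ of bounded operators that is a two-sided ideal and contains all finite-rank operators; it is closed if it is closed in the operator norm, and small if it consists of strictly singular operators, i.e. of operators that are not an isomorphism onto the image on any infinite-dimensional subspace. (a) There is a family $(I_A)_{A\subset\mathbb R}$ of small closed operator ideals on $X$ such that for all $A,B\subset\mathbb R$: $I_A\subset I_B\iff A\subset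 B$. More precisely, $X$ contains normalized sequences equivalent to the unit vector basis of $c_0$, and there are infinite sets $J_r\subset\{1,2,\dots\}$, $r\in\mathbb R$, such that for every normalized sequence $(e_n)$ in $X$ that is equivalent to the unit vector basis of $c_0$ there is a bounded operator $T:X\to X$ with $T\tilde e_n=e_n$ for all $n$, and the closed operator ideals $I_A$ generated by $\{T\circ P_{J_r}: r\in A\}$, $A\subset\mathbb R$, form such a family. (b) There are exactly $2^{\mathfrak c}$ distinct small closed operator ideals on $X$. (c) The set of small closed operator ideals on $X$, ordered by inclusion, contains a chain of cardinality $\mathfrak c$ and an antichain of cardinality $2^{\mathfrak c}$. -/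

import Mathlib

open scoped Cardinal

/-- The Schreier families `S_0, S_1, S_2, …` of finite subsets of `{1, 2, 3, …}`: `S_0` consists of
the empty set and the singletons, and `S_{N+1}` of the unions `E_1 ∪ ⋯ ∪ E_k` of `k` successive
members `E_1 < ⋯ < E_k` of `S_N` with `k ≤ min E_1`. The empty set is obtained for `k = 0`. As
`E_1 < ⋯ < E_k`, the condition `k ≤ min E_1` says that `k ≤ n` for every `n` in the union; in this
form empty pieces `E_i` do no harm, since they can be deleted, which only decreases `k`. -/
def schreierFamily : ℕ → Set (Finset ℕ+)
  | 0 => {F | F = ∅ ∨ ∃ n, F = {n}}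
  | N + 1 => {F | ∃ (k : ℕ) (E : Fin k → Finset ℕ+),
      (∀ i, E i ∈ schreierFamily N) ∧
      (∀ i, ∀ n ∈ E i, k ≤ (n : ℕ)) ∧
      (∀ i j, i < j → ∀ m ∈ E i, ∀ n ∈ E j, m < n) ∧
      F = Finset.univ.biUnion E}

theorem empty_mem_schreierFamily (N : ℕ) : ∅ ∈ schreierFamily N := by
  cases N with
  | zero => exact Or.inl rfl
  | succ N =>
    exact ⟨0, fun _ => ∅, fun i => i.elim0, fun i => i.elim0, fun i => i.elim0, by simp⟩

theorem singleton_mem_schreierFamily (N : ℕ) (n : ℕ+) : {n} ∈ schreierFamily N := by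
  induction N with
  | zero => exact Or.inr ⟨n, rfl⟩
  | succ N ih =>
    refine ⟨1, fun _ => {n}, fun _ => ih, ?_, ?_, ?_⟩
    · intro i m hm
      rw [Finset.mem_singleton.mp hm]
      exact n.2
    · intro i j hij
      exact absurd hij (by simp [Subsingleton.elim i j])
    · ext m
      simp

noncomputable section

/-- The space `c₀₀` of finitely supported scalar sequences `(x_n)_{n ≥ 1}`, to be endowed with the
norm `‖x‖ = sup_{A ∈ S_N} ∑_{n ∈ A} |x_n|`. -/
def SchreierCore (𝕜 : Type*) [RCLike 𝕜] (_N : ℕ) : Type _ := ℕ+ →₀ 𝕜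

namespace SchreierCore

variable {𝕜 : Type*} [RCLike 𝕜] {N : ℕ}

instance : AddCommGroup (SchreierCore 𝕜 N) := inferInstanceAs (AddCommGroup (ℕ+ →₀ 𝕜))

instance : Module 𝕜 (SchreierCore 𝕜 N) := inferInstanceAs (Module 𝕜 (ℕ+ →₀ 𝕜))

/-- The identity map from `c₀₀` to `c₀₀` with the Schreier norm. -/
def ofFinsupp : (ℕ+ →₀ 𝕜) ≃ₗ[𝕜] SchreierCore 𝕜 N := LinearEquiv.refl 𝕜 (ℕ+ →₀ 𝕜)

/-- The `n`-th coordinate. -/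
def coeff (x : SchreierCore 𝕜 N) (n : ℕ+) : 𝕜 := (ofFinsupp.symm x) n

instance : Norm (SchreierCore 𝕜 N) :=
  ⟨fun x => ⨆ A : schreierFamily N, ∑ n ∈ A.1, ‖x.coeff n‖⟩

theorem norm_def (x : SchreierCore 𝕜 N) :
    ‖x‖ = ⨆ A : schreierFamily N, ∑ n ∈ A.1, ‖x.coeff n‖ := rfl

theorem coeff_add (x y : SchreierCore 𝕜 N) (n : ℕ+) : (x + y).coeff n = x.coeff n + y.coeff n := rfl

theorem coeff_smul (c : 𝕜) (x : SchreierCore 𝕜 N) (n : ℕ+) : (c • x).coeff n = c * x.coeff n := rfl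

theorem coeff_zero (n : ℕ+) : (0 : SchreierCore 𝕜 N).coeff n = 0 := rfl

theorem bddAbove_sum (x : SchreierCore 𝕜 N) :
    BddAbove (Set.range fun A : schreierFamily N => ∑ n ∈ A.1, ‖x.coeff n‖) := by
  refine ⟨∑ n ∈ (ofFinsupp.symm x).support, ‖x.coeff n‖, ?_⟩
  rintro _ ⟨A, rfl⟩
  have h : ∀ n ∈ A.1, n ∉ A.1 ∩ (ofFinsupp.symm x).support → ‖x.coeff n‖ = 0 := by
    intro n hn hn'
    have : n ∉ (ofFinsupp.symm x).support := fun h => hn' (Finset.mem_inter.mpr ⟨hn, h⟩)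
    rw [norm_eq_zero]
    exact Finsupp.notMem_support_iff.mp this
  show ∑ n ∈ A.1, ‖x.coeff n‖ ≤ _
  rw [← Finset.sum_subset Finset.inter_subset_left h]
  exact Finset.sum_le_sum_of_subset_of_nonneg Finset.inter_subset_right
    fun _ _ _ => norm_nonneg _

theorem sum_le_norm (x : SchreierCore 𝕜 N) {A : Finset ℕ+} (hA : A ∈ schreierFamily N) :
    ∑ n ∈ A, ‖x.coeff n‖ ≤ ‖x‖ :=
  le_ciSup (bddAbove_sum x) ⟨A, hA⟩

theorem norm_le (x : SchreierCore 𝕜 N) {C : ℝ}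
    (h : ∀ A ∈ schreierFamily N, ∑ n ∈ A, ‖x.coeff n‖ ≤ C) : ‖x‖ ≤ C :=
  haveI : Nonempty (schreierFamily N) := ⟨⟨∅, empty_mem_schreierFamily N⟩⟩
  ciSup_le fun A => h A.1 A.2

theorem normedSpaceCore : NormedSpace.Core 𝕜 (SchreierCore 𝕜 N) where
  norm_nonneg x := by simpa using sum_le_norm x (empty_mem_schreierFamily N)
  norm_smul c x := by
    rw [norm_def, norm_def, Real.mul_iSup_of_nonneg (norm_nonneg c)]
    simp only [coeff_smul, norm_mul, Finset.mul_sum]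
  norm_triangle x y := norm_le _ fun A hA => by
    calc ∑ n ∈ A, ‖(x + y).coeff n‖ ≤ ∑ n ∈ A, (‖x.coeff n‖ + ‖y.coeff n‖) :=
          Finset.sum_le_sum fun n _ => norm_add_le _ _
      _ = ∑ n ∈ A, ‖x.coeff n‖ + ∑ n ∈ A, ‖y.coeff n‖ := Finset.sum_add_distrib
      _ ≤ ‖x‖ + ‖y‖ := add_le_add (sum_le_norm x hA) (sum_le_norm y hA)
  norm_eq_zero_iff x := by
    constructor
    · intro h
      apply ofFinsupp.symm.injective
      ext n
      have h1 := sum_le_norm x (singleton_mem_schreierFamily N n)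
      rw [h, Finset.sum_singleton] at h1
      exact norm_le_zero_iff.mp h1
    · rintro rfl
      simp [norm_def, coeff_zero]

instance : NormedAddCommGroup (SchreierCore 𝕜 N) := NormedAddCommGroup.ofCore normedSpaceCore

instance : NormedSpace 𝕜 (SchreierCore 𝕜 N) := NormedSpace.ofCore normedSpaceCore

open Classical in
/-- The coordinate projection `∑ x_n ẽ_n ↦ ∑_{n ∈ I} x_n ẽ_n` on `c₀₀`. -/
def proj (I : Set ℕ+) : SchreierCore 𝕜 N →L[𝕜] SchreierCore 𝕜 N :=
  LinearMap.mkContinuous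
    (ofFinsupp.toLinearMap ∘ₗ (Finsupp.supported 𝕜 𝕜 I).subtype ∘ₗ Finsupp.restrictDom 𝕜 𝕜 I ∘ₗ
      ofFinsupp.symm.toLinearMap) 1 fun x => by
    rw [one_mul]
    refine norm_le _ fun A hA => le_trans (Finset.sum_le_sum fun n _ => ?_) (sum_le_norm x hA)
    show ‖Finsupp.filter (· ∈ I) (ofFinsupp.symm x) n‖ ≤ ‖(ofFinsupp.symm x) n‖
    rw [Finsupp.filter_apply]
    split_ifs <;> simp

end SchreierCore

/-- The Schreier space `X[S_N]`: the completion of `c₀₀` with the norm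
`‖x‖ = sup_{A ∈ S_N} ∑_{n ∈ A} |x_n|`. -/
abbrev SchreierSpace (𝕜 : Type*) [RCLike 𝕜] (N : ℕ) : Type _ :=
  UniformSpace.Completion (SchreierCore 𝕜 N)

namespace SchreierSpace

variable (𝕜 : Type*) [RCLike 𝕜] (N : ℕ)

/-- The unit vector basis `(ẽ_n)_{n ≥ 1}` of the Schreier space. -/
def basis (n : ℕ+) : SchreierSpace 𝕜 N :=
  ((SchreierCore.ofFinsupp (Finsupp.single n 1) : SchreierCore 𝕜 N) : SchreierSpace 𝕜 N)

/-- The canonical projection `P_I` of the Schreier space onto the closed span of the basis vectors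
`ẽ_n`, `n ∈ I`: the continuous extension of the coordinate projection on `c₀₀`. -/
def proj (I : Set ℕ+) : SchreierSpace 𝕜 N →L[𝕜] SchreierSpace 𝕜 N :=
  (UniformSpace.Completion.toComplL.comp (SchreierCore.proj I)).extend
    (UniformSpace.Completion.toComplL : SchreierCore 𝕜 N →L[𝕜] SchreierSpace 𝕜 N)

/-- `P_I` is indeed the continuous extension of the coordinate projection on `c₀₀`. -/
theorem proj_coe (I : Set ℕ+) (x : SchreierCore 𝕜 N) :
    proj 𝕜 N I (x : SchreierSpace 𝕜 N) = (SchreierCore.proj I x : SchreierCore 𝕜 N) :=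
  ContinuousLinearMap.extend_eq _ UniformSpace.Completion.denseRange_coe
    (UniformSpace.Completion.isUniformInducing_coe _) x

open Classical in
theorem proj_basis (I : Set ℕ+) (n : ℕ+) :
    proj 𝕜 N I (basis 𝕜 N n) = if n ∈ I then basis 𝕜 N n else 0 := by
  rw [basis, proj_coe]
  have h : SchreierCore.proj I (SchreierCore.ofFinsupp (Finsupp.single n 1) : SchreierCore 𝕜 N) =
      SchreierCore.ofFinsupp (Finsupp.filter (· ∈ I) (Finsupp.single n 1)) := rfl
  rw [h]
  split_ifs with hn
  · rw [Finsupp.filter_single_of_pos _ hn]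
  · rw [Finsupp.filter_single_of_neg _ hn, map_zero, UniformSpace.Completion.coe_zero]

end SchreierSpace

section Operators

variable {𝕜 : Type*} [RCLike 𝕜] {X : Type*} [NormedAddCommGroup X] [NormedSpace 𝕜 X]

/-- `(e_n)` is a normalized sequence equivalent to the unit vector basis of `c₀` (and hence a basic
sequence): `‖e_n‖ = 1`, and `‖∑ a_n e_n‖` and `sup |a_n|` are equivalent for finitely supported
scalar sequences `(a_n)`. -/
def IsNormalizedC0Sequence (𝕜 : Type*) [RCLike 𝕜] {X : Type*} [NormedAddCommGroup X]
    [NormedSpace 𝕜 X] (e : ℕ+ → X) : Prop :=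
  (∀ n, ‖e n‖ = 1) ∧ ∃ c C : ℝ, 0 < c ∧ ∀ a : ℕ+ →₀ 𝕜,
    c * (⨆ n, ‖a n‖) ≤ ‖a.sum fun n t => t • e n‖ ∧
      ‖a.sum fun n t => t • e n‖ ≤ C * (⨆ n, ‖a n‖)

/-- A bounded operator is strictly singular if its restriction to an infinite-dimensional subspace
is never an isomorphism onto its image, that is, never bounded below. -/
def IsStrictlySingular (T : X →L[𝕜] X) : Prop :=
  ∀ Z : Submodule 𝕜 X, ¬ FiniteDimensional 𝕜 Z → ¬ ∃ c : ℝ, 0 < c ∧ ∀ z ∈ Z, c * ‖z‖ ≤ ‖T z‖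

/-- An operator ideal in the algebra of bounded operators on `X`: a linear subspace which contains
the operators of finite rank and is a two-sided ideal. -/
structure IsOperatorIdeal (I : Submodule 𝕜 (X →L[𝕜] X)) : Prop where
  finiteRank_mem : ∀ T : X →L[𝕜] X, FiniteDimensional 𝕜 T.range → T ∈ I
  comp_mem_left : ∀ S T : X →L[𝕜] X, T ∈ I → S ∘L T ∈ I
  comp_mem_right : ∀ S T : X →L[𝕜] X, T ∈ I → T ∘L S ∈ I

/-- Closed operator ideals, with respect to the operator norm. -/
structure IsClosedOperatorIdeal (I : Submodule 𝕜 (X →L[𝕜] X)) : Prop extends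
    IsOperatorIdeal I where
  isClosed : IsClosed (I : Set (X →L[𝕜] X))

/-- Small closed operator ideals: those that consist of strictly singular operators. -/
structure IsSmallClosedIdeal (I : Submodule 𝕜 (X →L[𝕜] X)) : Prop extends
    IsClosedOperatorIdeal I where
  strictlySingular : ∀ T ∈ I, IsStrictlySingular T

/-- The closed operator ideal generated by a family of operators: the smallest closed operator ideal
that contains the family. -/
def closedIdealSpan (B : Set (X →L[𝕜] X)) : Submodule 𝕜 (X →L[𝕜] X) :=
  sInf {I | IsClosedOperatorIdeal I ∧ B ⊆ I}

theorem isClosedOperatorIdeal_closedIdealSpan (B : Set (X →L[𝕜] X)) :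
    IsClosedOperatorIdeal (closedIdealSpan B) where
  finiteRank_mem T hT := by
    refine (Submodule.mem_sInf).mpr fun I hI => hI.1.finiteRank_mem T hT
  comp_mem_left S T hT := by
    refine (Submodule.mem_sInf).mpr fun I hI =>
      hI.1.comp_mem_left S T ((Submodule.mem_sInf).mp hT I hI)
  comp_mem_right S T hT := by
    refine (Submodule.mem_sInf).mpr fun I hI =>
      hI.1.comp_mem_right S T ((Submodule.mem_sInf).mp hT I hI)
  isClosed := by
    rw [closedIdealSpan, Submodule.coe_sInf]
    exact isClosed_biInter fun I hI => hI.1.isClosed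

end Operators

end

/-!
The formal inclusion `T : ẽ_n ↦ e_n` satisfies `‖T x‖ ≤ C sup |x_n|`, because `(e_n)` is equivalent
to the unit vector basis of `c₀`. The sets `J_r` are unions of finite blocks `B_k`, `k ∈ A_r`, where
`(A_r)` is an almost disjoint family of sets of integers and `B_k` is the support of a convex
combination `x_k` of unit vectors. The `x_k` are successive, and the norm of `x_k` is small even
compared with the reciprocal of the position `p_k` at which `B_k` begins. Such averages exist by
induction on the level of the Schreier family (`exists_isSmallAverage`): averages that are small for
`S_M` and supported by members of `S_{M+1}` have, if they are spread rapidly enough, uniformly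
bounded sums on the sets in `S_{M+1}` (`IsRapid.sum_sum_le`), so that the mean of many of them is
small for `S_{M+1}`. The same estimate, one level lower, shows that the `x_k` yield a sequence
equivalent to the unit vector basis of `c₀` (`exists_isNormalizedC0Sequence`).

To separate the ideals, consider for fixed `r` the operators `R` such that, for all operators `V`,
the averages `∑_n x_k(n) ‖R V ẽ_n‖` tend to `0` along `k ∈ A_r` (`averageNullOperators`). It is
immediate that they form a closed ideal, and `T P_{J_r}` is not among them since `‖e_n‖ = 1`. But
`T P_{J_s}` is, for `s ≠ r`: if `k ∈ A_r` is large, then `J_s` does not meet the interval of `B_k`.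
By a choice of signs the average is dominated by the `ℓ₁`-norm of `V x_k` over a set of at most
`p_k` points below `B_k`, and of at most `|B_k|` points above it, which belong to `S_1`. So it is at
most a multiple of `(p_k + 1) ‖x_k‖` (`IsSupBounded.mem_averageNullOperators`). Hence `T P_{J_r}`
does not belong to the closed ideal generated by any family of `T P_{J_s}` with `s ≠ r`.

That the ideals are small is seen from another closed ideal, which consists of strictly singular
operators: the operators which have, on every infinite-dimensional subspace, arbitrarily small norm
on some infinite-dimensional subspace of it (`hereditarilySmallOperators`). A gliding hump argument
shows that it contains all `T P_J`.

For the cardinalities, an operator is determined by the coordinates of the images of the `ẽ_n`, so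
there are at most `𝔠` operators. The lower bounds, the chain and the antichain come from the power
set of `ℝ`.
-/

/-! ### Schreier families and rapidly spread averages -/

theorem schreierFamily_subset_succ (M : ℕ) : schreierFamily M ⊆ schreierFamily (M + 1) := by
  intro F hF
  refine ⟨1, fun _ => F, fun _ => hF, fun _ n _ => n.2, fun i j hij => ?_, ?_⟩
  · exact absurd hij (by simp [Subsingleton.elim i j])
  · ext m
    simp

theorem mem_schreierFamily_of_card_le (M : ℕ) {F : Finset ℕ+} (hF : ∀ n ∈ F, F.card ≤ (n : ℕ)) :
    F ∈ schreierFamily (M + 1) := by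
  induction M with
  | zero =>
    refine ⟨F.card, fun i => {F.orderEmbOfFin rfl i}, fun i => singleton_mem_schreierFamily 0 _,
      fun i n hn => ?_, fun i j hij m hm n hn => ?_, ?_⟩
    · rw [Finset.mem_singleton.mp hn]
      exact hF _ (F.orderEmbOfFin_mem rfl i)
    · rw [Finset.mem_singleton.mp hm, Finset.mem_singleton.mp hn]
      exact (F.orderEmbOfFin rfl).strictMono hij
    · ext m
      simp only [Finset.mem_biUnion, Finset.mem_univ, Finset.mem_singleton, true_and]
      rw [← Finset.mem_coe, ← Finset.range_orderEmbOfFin F rfl]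
      exact ⟨fun ⟨i, hi⟩ => ⟨i, hi.symm⟩, fun ⟨i, hi⟩ => ⟨i, hi.symm⟩⟩
  | succ M ih => exact schreierFamily_subset_succ _ ih

/-- Dependent choice for gliding hump constructions: the `k`-th object `x k` starts after
position `p k` and is dealt with by position `p (k + 1)`. -/
theorem exists_gliding_seq {α : Type*} (P : ℕ → ℕ → α → ℕ → Prop)
    (h : ∀ k p, 1 ≤ p → ∃ x q, p ≤ q ∧ P k p x q) (q : ℕ) (hq : 1 ≤ q) :
    ∃ (p : ℕ → ℕ) (x : ℕ → α), p 0 = q ∧ Monotone p ∧ ∀ k, P k (p k) (x k) (p (k + 1)) := by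
  have : Nonempty α := (h 0 1 le_rfl).nonempty
  choose! X Q hQ hP using h
  let p : ℕ → ℕ := fun k => Nat.rec q (fun k p => Q k p) k
  have hp : ∀ k, 1 ≤ p k := by
    intro k
    induction k with
    | zero => exact hq
    | succ k ih => exact ih.trans (hQ k _ ih)
  exact ⟨p, fun k => X k (p k), rfl, monotone_nat_of_le_succ fun k => hQ k _ (hp k),
    fun k => hP k _ (hp k)⟩

/-- A convex combination `x` of unit vectors with indices above `q`, supported by a member of
`S_{M+1}`, whose mass on every member of `S_M` is at most `η`. -/
structure IsSmallAverage (M q : ℕ) (η : ℝ) (x : ℕ+ →₀ ℝ) : Prop where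
  nonneg : ∀ n, 0 ≤ x n
  sum_eq : ∑ n ∈ x.support, x n = 1
  support_mem : x.support ∈ schreierFamily (M + 1)
  lt : ∀ n ∈ x.support, q < (n : ℕ)
  small : ∀ F ∈ schreierFamily M, ∑ n ∈ F, x n ≤ η

theorem IsSmallAverage.sum_le_one {M q : ℕ} {η : ℝ} {x : ℕ+ →₀ ℝ} (h : IsSmallAverage M q η x)
    (F : Finset ℕ+) : ∑ n ∈ F, x n ≤ 1 := by
  rw [← h.sum_eq, ← Finset.sum_filter_ne_zero]
  refine Finset.sum_le_sum_of_subset_of_nonneg (fun n hn => ?_) fun n _ _ => h.nonneg n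
  exact Finsupp.mem_support_iff.mpr (Finset.mem_filter.mp hn).2

theorem IsSmallAverage.support_nonempty {M q : ℕ} {η : ℝ} {x : ℕ+ →₀ ℝ}
    (h : IsSmallAverage M q η x) : x.support.Nonempty := by
  rw [Finset.nonempty_iff_ne_empty]
  intro h0
  simpa [h0] using h.sum_eq

/-- A successive sequence of small averages, the `k`-th being supported in `(p k, p (k + 1)]` and
having mass at most `2 ^ (-(k + 1)) / p k` on the members of `S_M`. -/
structure IsRapid (M : ℕ) (p : ℕ → ℕ) (x : ℕ → ℕ+ →₀ ℝ) : Prop where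
  one_le : ∀ k, 1 ≤ p k
  mono : Monotone p
  average : ∀ k, IsSmallAverage M (p k) ((1 / 2) ^ (k + 1) / p k) (x k)
  le : ∀ k, ∀ n ∈ (x k).support, (n : ℕ) ≤ p (k + 1)

theorem sum_half_pow_le (K : ℕ) : ∑ k ∈ Finset.range K, (1 / 2 : ℝ) ^ (k + 1) ≤ 1 := by
  have h : ∑ k ∈ Finset.range K, (1 / 2 : ℝ) ^ (k + 1) = 1 - (1 / 2) ^ K := by
    induction K with
    | zero => simp
    | succ K ih => rw [Finset.sum_range_succ, ih]; ring
  rw [h]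
  have : (0 : ℝ) ≤ (1 / 2) ^ K := by positivity
  linarith

/-- If `F ∈ S_{M+1}` meets the supports of a rapid sequence first in that of `x i`, then `F` is a
union of at most `p (i + 1)` members of `S_M`, on which the later `x k` have small mass. Hence the
sum of all the masses on `F` is bounded. -/
theorem IsRapid.sum_sum_le {M : ℕ} {p : ℕ → ℕ} {x : ℕ → ℕ+ →₀ ℝ} (h : IsRapid M p x)
    {F : Finset ℕ+} (hF : F ∈ schreierFamily (M + 1)) (K : ℕ) :
    ∑ k ∈ Finset.range K, ∑ n ∈ F, x k n ≤ 2 := by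
  classical
  have hnn : ∀ k, 0 ≤ ∑ n ∈ F, x k n := fun k => Finset.sum_nonneg fun n _ => (h.average k).nonneg n
  by_cases hex : ∃ k, ∑ n ∈ F, x k n ≠ 0
  swap
  · push Not at hex
    simp [hex]
  obtain ⟨n, hnF, hn⟩ := Finset.exists_ne_zero_of_sum_ne_zero (Nat.find_spec hex)
  set i := Nat.find hex
  have hlt : ∀ k < i, ∑ n ∈ F, x k n = 0 := fun k hk => not_not.mp (Nat.find_min hex hk)
  have hni : (n : ℕ) ≤ p (i + 1) := h.le i n (Finsupp.mem_support_iff.mpr hn)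
  obtain ⟨t, E, hE, ht, hlt', rfl⟩ := hF
  have htn : t ≤ n := by
    obtain ⟨m, -, hm⟩ := Finset.mem_biUnion.mp hnF
    exact ht m n hm
  have key : ∀ k, ∑ n ∈ Finset.univ.biUnion E, x k n ≤
      (if k = i then 1 else 0) + (1 / 2 : ℝ) ^ (k + 1) := by
    intro k
    have hpos : (0 : ℝ) ≤ (1 / 2 : ℝ) ^ (k + 1) := by positivity
    rcases lt_trichotomy k i with hk | hk | hk
    · rw [hlt k hk, if_neg hk.ne, zero_add]
      exact hpos
    · rw [if_pos hk]
      linarith [(h.average k).sum_le_one (Finset.univ.biUnion E)]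
    · rw [if_neg hk.ne', zero_add]
      have hpk : (0 : ℝ) < p k := by exact_mod_cast h.one_le k
      have htp : (t : ℝ) ≤ p k := by exact_mod_cast (htn.trans hni).trans (h.mono hk)
      calc ∑ n ∈ Finset.univ.biUnion E, x k n ≤ ∑ m, ∑ n ∈ E m, x k n :=
            (Finset.sum_biUnion fun i _ j _ hij => Finset.disjoint_left.mpr fun n hi hj => by
              rcases lt_or_gt_of_ne hij with h' | h'
              · exact lt_irrefl n (hlt' i j h' n hi n hj)
              · exact lt_irrefl n (hlt' j i h' n hj n hi)).le
        _ ≤ ∑ _m : Fin t, (1 / 2 : ℝ) ^ (k + 1) / p k :=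
            Finset.sum_le_sum fun m _ => (h.average k).small _ (hE m)
        _ = t * ((1 / 2 : ℝ) ^ (k + 1) / p k) := by simp
        _ ≤ p k * ((1 / 2 : ℝ) ^ (k + 1) / p k) := by gcongr
        _ = (1 / 2 : ℝ) ^ (k + 1) := by field_simp
  calc _ ≤ ∑ k ∈ Finset.range K, ((if k = i then 1 else 0) + (1 / 2 : ℝ) ^ (k + 1)) :=
        Finset.sum_le_sum fun k _ => key k
    _ ≤ 1 + 1 := by
        rw [Finset.sum_add_distrib]
        refine add_le_add ?_ (sum_half_pow_le K)
        rw [Finset.sum_ite_eq']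
        split_ifs <;> norm_num
    _ = 2 := by norm_num

theorem exists_isRapid_of_exists_isSmallAverage {M : ℕ}
    (h : ∀ q : ℕ, ∀ η : ℝ, 0 < η → ∃ x, IsSmallAverage M q η x) (q : ℕ) (hq : 1 ≤ q) :
    ∃ p x, p 0 = q ∧ IsRapid M p x := by
  obtain ⟨p, x, h0, hm, hP⟩ := exists_gliding_seq
    (fun k p x p' => IsSmallAverage M p ((1 / 2) ^ (k + 1) / p) x ∧ ∀ n ∈ x.support, (n : ℕ) ≤ p')
    (fun k p hp => by
      have hp' : (0 : ℝ) < p := by exact_mod_cast hp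
      obtain ⟨x, hx⟩ := h p ((1 / 2) ^ (k + 1) / p) (by positivity)
      exact ⟨x, p + x.support.sup (fun n => (n : ℕ)), by lia, hx, fun n hn =>
        (Finset.le_sup (f := fun n : ℕ+ => (n : ℕ)) hn).trans (by lia)⟩) q hq
  exact ⟨p, x, h0, fun k => hq.trans (h0 ▸ hm (zero_le)), hm, fun k => (hP k).1, fun k => (hP k).2⟩

theorem exists_isSmallAverage (M : ℕ) :
    ∀ q : ℕ, ∀ η : ℝ, 0 < η → ∃ x, IsSmallAverage M q η x := by
  classical
  induction M with
  | zero =>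
    intro q η hη
    obtain ⟨d, hd⟩ := exists_nat_gt (1 / η)
    have hd0 : (0 : ℝ) < d := (by positivity : (0 : ℝ) < 1 / η).trans hd
    have hdη : 1 / (d : ℝ) ≤ η := by
      rw [div_le_iff₀ hd0]
      rw [div_lt_iff₀ hη] at hd
      linarith
    -- the uniform average over `d` consecutive integers above both `q` and `d`
    let f : ℕ → ℕ+ := fun i => ⟨q + d + i + 1, Nat.succ_pos _⟩
    have hf : Function.Injective f := fun i j hij => by
      have := congrArg PNat.val hij
      simpa [f] using this
    set F := (Finset.range d).image f with hF
    have hcard : F.card = d := by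
      rw [hF, Finset.card_image_of_injective _ hf, Finset.card_range]
    have hmem : ∀ n ∈ F, q + d < (n : ℕ) := by
      intro n hn
      obtain ⟨i, -, rfl⟩ := Finset.mem_image.mp hn
      show q + d < q + d + i + 1
      lia
    let x : ℕ+ →₀ ℝ := Finsupp.onFinset F (fun n => if n ∈ F then 1 / (d : ℝ) else 0)
      (fun n hn => by by_contra h; exact hn (if_neg h))
    have hx : ∀ n, x n = if n ∈ F then 1 / (d : ℝ) else 0 := fun n => rfl
    have hsupp : x.support = F := by
      ext n
      rw [Finsupp.mem_support_iff, hx]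
      split_ifs with h
      · simp [h, hd0.ne']
      · simp [h]
    refine ⟨x, fun n => ?_, ?_, ?_, fun n hn => ?_, fun G hG => ?_⟩
    · rw [hx]
      split_ifs <;> positivity
    · rw [hsupp, Finset.sum_congr rfl fun n hn => (hx n).trans (if_pos hn), Finset.sum_const, hcard,
        nsmul_eq_mul]
      field_simp
    · rw [hsupp]
      refine mem_schreierFamily_of_card_le 0 fun n hn => ?_
      have := hmem n hn
      lia
    · have := hmem n (hsupp ▸ hn)
      lia
    · rcases hG with rfl | ⟨n, rfl⟩
      · simpa using hη.le
      · rw [Finset.sum_singleton, hx]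
        split_ifs
        · exact hdη
        · exact hη.le
  | succ M ih =>
    intro q η hη
    obtain ⟨d, hd⟩ := exists_nat_gt (2 / η)
    have hd0 : (0 : ℝ) < d := (by positivity : (0 : ℝ) < 2 / η).trans hd
    have hdη : 2 / (d : ℝ) ≤ η := by
      rw [div_le_iff₀ hd0]
      rw [div_lt_iff₀ hη] at hd
      linarith
    -- the average of the first `d` terms of a rapid sequence which starts above `q` and `d`
    obtain ⟨p, x, hp0, hx⟩ := exists_isRapid_of_exists_isSmallAverage ih (q + d + 1) (by lia)
    have hp : ∀ k, ∀ n ∈ (x k).support, q + d < (n : ℕ) := by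
      intro k n hn
      have h1 := (hx.average k).lt n hn
      have h2 := hx.mono (Nat.zero_le k)
      lia
    let y : ℕ+ →₀ ℝ := (1 / (d : ℝ)) • ∑ i ∈ Finset.range d, x i
    have hy : ∀ n, y n = 1 / (d : ℝ) * ∑ i ∈ Finset.range d, x i n := by
      intro n
      simp [y]
    have hsupp : y.support = (Finset.univ : Finset (Fin d)).biUnion fun i => (x i).support := by
      ext n
      rw [Finsupp.mem_support_iff, hy, mul_ne_zero_iff_left (by positivity), Ne,
        Finset.sum_eq_zero_iff_of_nonneg fun i _ => (hx.average i).nonneg n]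
      simp [Fin.exists_iff]
    have hsum : ∀ F : Finset ℕ+, ∑ n ∈ F, y n =
        1 / (d : ℝ) * ∑ i ∈ Finset.range d, ∑ n ∈ F, x i n := by
      intro F
      rw [Finset.sum_comm, Finset.mul_sum]
      exact Finset.sum_congr rfl fun n _ => hy n
    refine ⟨y, fun n => ?_, ?_, ?_, fun n hn => ?_, fun G hG => ?_⟩
    · rw [hy]
      exact mul_nonneg (by positivity) (Finset.sum_nonneg fun i _ => (hx.average i).nonneg n)
    · rw [hsum]
      have : ∀ i ∈ Finset.range d, ∑ n ∈ y.support, x i n = 1 := by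
        intro i hi
        rw [← (hx.average i).sum_eq]
        refine (Finset.sum_subset ?_ fun n _ hn => Finsupp.notMem_support_iff.mp hn).symm
        rw [hsupp]
        exact Finset.subset_biUnion_of_mem (fun i : Fin d => (x i).support)
          (Finset.mem_univ (⟨i, Finset.mem_range.mp hi⟩ : Fin d))
      rw [Finset.sum_congr rfl this]
      simp [hd0.ne']
    · rw [hsupp]
      refine ⟨d, fun i => (x i).support, fun i => (hx.average i).support_mem, fun i n hn => ?_,
        fun i j hij m hm n hn => ?_, rfl⟩
      · have := hp i n hn
        lia
      · have h1 := hx.le i m hm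
        have h2 := (hx.average j).lt n hn
        have h3 : p (i + 1) ≤ p j := hx.mono hij
        exact PNat.coe_lt_coe _ _ |>.mp (by lia)
    · rw [hsupp] at hn
      obtain ⟨i, -, hi⟩ := Finset.mem_biUnion.mp hn
      have := hp i n hi
      lia
    · rw [hsum]
      refine le_trans ?_ hdη
      rw [div_eq_mul_one_div 2 (d : ℝ), mul_comm]
      gcongr
      exact hx.sum_sum_le hG d

theorem exists_isRapid (M : ℕ) : ∃ p x, IsRapid M p x := by
  obtain ⟨p, x, -, h⟩ := exists_isRapid_of_exists_isSmallAverage (exists_isSmallAverage M) 1 le_rfl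
  exact ⟨p, x, h⟩

/-! ### Coordinates on the Schreier space -/

noncomputable section

namespace SchreierSpace

variable {𝕜 : Type*} [RCLike 𝕜] {N : ℕ}

theorem denseRange_coe :
    DenseRange (UniformSpace.Completion.toComplL : SchreierCore 𝕜 N →L[𝕜] SchreierSpace 𝕜 N) :=
  UniformSpace.Completion.denseRange_coe

variable (𝕜 N) in
/-- The `n`-th coordinate functional on the Schreier space, the continuous extension of the
coordinate on `c₀₀`. -/
def coord (n : ℕ+) : SchreierSpace 𝕜 N →L[𝕜] 𝕜 :=
  (LinearMap.mkContinuous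
    { toFun := fun x : SchreierCore 𝕜 N => x.coeff n
      map_add' := fun _ _ => rfl
      map_smul' := fun _ _ => rfl } 1 fun x => by
    rw [one_mul]
    refine le_trans (le_of_eq ?_) (SchreierCore.sum_le_norm x (singleton_mem_schreierFamily N n))
    rw [Finset.sum_singleton]
    rfl).extend
    (UniformSpace.Completion.toComplL : SchreierCore 𝕜 N →L[𝕜] SchreierSpace 𝕜 N)

theorem coord_coe (n : ℕ+) (x : SchreierCore 𝕜 N) :
    coord 𝕜 N n (x : SchreierSpace 𝕜 N) = x.coeff n :=
  ContinuousLinearMap.extend_eq _ denseRange_coe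
    (UniformSpace.Completion.isUniformInducing_coe _) x

open Classical in
theorem coord_basis (n m : ℕ+) : coord 𝕜 N n (basis 𝕜 N m) = if m = n then 1 else 0 := by
  rw [basis, coord_coe]
  exact Finsupp.single_apply

theorem sum_norm_coord_le (x : SchreierSpace 𝕜 N) {F : Finset ℕ+} (hF : F ∈ schreierFamily N) :
    ∑ n ∈ F, ‖coord 𝕜 N n x‖ ≤ ‖x‖ := by
  induction x using UniformSpace.Completion.induction_on with
  | hp => exact isClosed_le (by fun_prop) continuous_norm
  | ih y =>
    simp only [coord_coe, UniformSpace.Completion.norm_coe]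
    exact SchreierCore.sum_le_norm y hF

theorem norm_coord_le (x : SchreierSpace 𝕜 N) (n : ℕ+) : ‖coord 𝕜 N n x‖ ≤ ‖x‖ := by
  simpa using sum_norm_coord_le x (singleton_mem_schreierFamily N n)

theorem exists_core_near (x : SchreierSpace 𝕜 N) {ε : ℝ} (hε : 0 < ε) :
    ∃ y : SchreierCore 𝕜 N, ‖x - y‖ < ε := by
  obtain ⟨y, hy⟩ := Metric.denseRange_iff.mp (denseRange_coe (𝕜 := 𝕜) (N := N)) x ε hε
  exact ⟨y, by rwa [dist_eq_norm] at hy⟩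

theorem sum_norm_coord_le_add (x y : SchreierSpace 𝕜 N) {F : Finset ℕ+}
    (hF : F ∈ schreierFamily N) :
    ∑ n ∈ F, ‖coord 𝕜 N n x‖ ≤ ∑ n ∈ F, ‖coord 𝕜 N n y‖ + ‖x - y‖ := by
  refine le_trans ?_ (add_le_add_right (sum_norm_coord_le (x - y) hF) _)
  rw [← Finset.sum_add_distrib]
  refine Finset.sum_le_sum fun n _ => ?_
  rw [map_sub]
  exact norm_le_insert' _ _

theorem exists_norming (x : SchreierSpace 𝕜 N) {ε : ℝ} (hε : 0 < ε) :
    ∃ F ∈ schreierFamily N, ‖x‖ - ε ≤ ∑ n ∈ F, ‖coord 𝕜 N n x‖ := by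
  by_contra! h
  obtain ⟨y, hy⟩ := exists_core_near x (half_pos (half_pos hε))
  have h1 : ‖y‖ ≤ ‖x‖ - ε + ε / 2 / 2 := SchreierCore.norm_le y fun F hF => by
    have h2 := sum_norm_coord_le_add (y : SchreierSpace 𝕜 N) x hF
    rw [norm_sub_rev] at h2
    simp only [coord_coe] at h2
    linarith [h F hF]
  have h3 : ‖x‖ ≤ ‖(y : SchreierSpace 𝕜 N)‖ + ‖x - y‖ := norm_le_insert' _ _
  rw [UniformSpace.Completion.norm_coe] at h3
  linarith

theorem norm_le_of_coord (x : SchreierSpace 𝕜 N) {C : ℝ}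
    (h : ∀ F ∈ schreierFamily N, ∑ n ∈ F, ‖coord 𝕜 N n x‖ ≤ C) : ‖x‖ ≤ C := by
  refine le_of_forall_pos_le_add fun ε hε => ?_
  obtain ⟨F, hF, h1⟩ := exists_norming x hε
  linarith [h F hF]

theorem exists_tail_le (x : SchreierSpace 𝕜 N) {ε : ℝ} (hε : 0 < ε) :
    ∃ p : ℕ, ∀ F ∈ schreierFamily N, (∀ n ∈ F, p < (n : ℕ)) → ∑ n ∈ F, ‖coord 𝕜 N n x‖ ≤ ε := by
  obtain ⟨y, hy⟩ := exists_core_near x hε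
  refine ⟨(SchreierCore.ofFinsupp.symm y).support.sup fun n => (n : ℕ), fun F hF hp => ?_⟩
  refine (sum_norm_coord_le_add x y hF).trans ?_
  rw [Finset.sum_eq_zero, zero_add]
  · exact hy.le
  · intro n hn
    rw [coord_coe, norm_eq_zero]
    refine Finsupp.notMem_support_iff.mp fun h => ?_
    exact absurd (hp n hn) (not_lt.mpr (Finset.le_sup (f := fun n : ℕ+ => (n : ℕ)) h))

open Classical in
theorem coord_sum_smul_basis (B : Finset ℕ+) (c : ℕ+ → 𝕜) (m : ℕ+) :
    coord 𝕜 N m (∑ n ∈ B, c n • basis 𝕜 N n) = if m ∈ B then c m else 0 := by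
  simp [map_sum, coord_basis]

theorem norm_basis (n : ℕ+) : ‖basis 𝕜 N n‖ = 1 := by
  classical
  refine le_antisymm (norm_le_of_coord _ fun F _ => ?_) ?_
  · simp only [coord_basis]
    calc ∑ m ∈ F, ‖(if n = m then (1 : 𝕜) else 0)‖ = ∑ m ∈ F, if n = m then (1 : ℝ) else 0 :=
          Finset.sum_congr rfl fun m _ => by split_ifs <;> simp
      _ ≤ 1 := by rw [Finset.sum_ite_eq]; split_ifs <;> norm_num
  · simpa [coord_basis] using norm_coord_le (basis 𝕜 N n) n

theorem coe_ofFinsupp (a : ℕ+ →₀ 𝕜) :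
    ((SchreierCore.ofFinsupp a : SchreierCore 𝕜 N) : SchreierSpace 𝕜 N) =
      a.sum fun n t => t • basis 𝕜 N n := by
  induction a using Finsupp.induction_linear with
  | zero => rw [map_zero, UniformSpace.Completion.coe_zero, Finsupp.sum_zero_index]
  | add f g hf hg =>
    rw [map_add, UniformSpace.Completion.coe_add, hf, hg,
      Finsupp.sum_add_index' (h := fun n t => t • basis 𝕜 N n) (fun _ => zero_smul _ _)
        fun _ _ _ => add_smul _ _ _]
  | single n t =>
    rw [Finsupp.sum_single_index (h := fun n t => t • basis 𝕜 N n) (zero_smul _ _), basis, ← UniformSpace.Completion.coe_smul,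
      ← map_smul, Finsupp.smul_single, smul_eq_mul, mul_one]

/-! ### Operators bounded by the supremum of the coordinates -/

/-- `‖R x‖ ≤ C sup_{j ∈ J} |x_j|`: up to the constant, `R` factors through the formal inclusion into
`c₀` of the coordinates in `J`. -/
def IsSupBounded (R : SchreierSpace 𝕜 N →L[𝕜] SchreierSpace 𝕜 N) (J : Set ℕ+) (C : ℝ) : Prop :=
  ∀ x b, (∀ j ∈ J, ‖coord 𝕜 N j x‖ ≤ b) → ‖R x‖ ≤ C * b

theorem IsSupBounded.exists_coord {R : SchreierSpace 𝕜 N →L[𝕜] SchreierSpace 𝕜 N} {J : Set ℕ+}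
    {C : ℝ} (h : IsSupBounded R J C) (hC : 0 < C) (x : SchreierSpace 𝕜 N)
    {ε : ℝ} (hε : 0 < ε) : ∃ j ∈ J, ‖R x‖ ≤ C * ‖coord 𝕜 N j x‖ + ε := by
  by_contra! h1
  have h2 := h x ((‖R x‖ - ε) / C) fun j hj => by
    rw [le_div_iff₀ hC]
    linarith [h1 j hj]
  rw [mul_div_cancel₀ _ hC.ne'] at h2
  linarith

open Classical in
theorem coord_proj_core (J : Set ℕ+) (y : SchreierCore 𝕜 N) (n : ℕ+) :
    (SchreierCore.proj J y).coeff n = if n ∈ J then y.coeff n else 0 := by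
  show Finsupp.filter (· ∈ J) (SchreierCore.ofFinsupp.symm y) n = _
  rw [Finsupp.filter_apply]
  rfl

/-- The operator `ẽ_n ↦ e_n` for a sequence `(e_n)` equivalent to the unit vector basis of `c₀`. It
is bounded since the supremum norm is at most the Schreier norm. -/
theorem exists_operator_of_c0 {e : ℕ+ → SchreierSpace 𝕜 N} (he : IsNormalizedC0Sequence 𝕜 e) :
    ∃ (T : SchreierSpace 𝕜 N →L[𝕜] SchreierSpace 𝕜 N) (C : ℝ), 0 < C ∧
      (∀ n, T (basis 𝕜 N n) = e n) ∧
      ∀ J : Set ℕ+, J.Nonempty → IsSupBounded (T ∘L proj 𝕜 N J) J C := by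
  classical
  obtain ⟨-, c, C₀, -, h⟩ := he
  set C := max C₀ 1
  have hC : 0 < C := lt_max_of_lt_right one_pos
  let f : SchreierCore 𝕜 N →ₗ[𝕜] SchreierSpace 𝕜 N :=
    Finsupp.linearCombination 𝕜 e ∘ₗ SchreierCore.ofFinsupp.symm.toLinearMap
  have hf : ∀ (y : SchreierCore 𝕜 N) (b : ℝ), (∀ j, ‖y.coeff j‖ ≤ b) → ‖f y‖ ≤ C * b := by
    intro y b hb
    have hs : (⨆ n, ‖y.coeff n‖) ≤ b := ciSup_le hb
    have h0 : 0 ≤ ⨆ n, ‖y.coeff n‖ := Real.iSup_nonneg fun n => norm_nonneg _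
    calc ‖f y‖ ≤ C₀ * ⨆ n, ‖y.coeff n‖ := (h (SchreierCore.ofFinsupp.symm y)).2
      _ ≤ C * ⨆ n, ‖y.coeff n‖ := by gcongr; exact le_max_left _ _
      _ ≤ C * b := by gcongr
  let g : SchreierCore 𝕜 N →L[𝕜] SchreierSpace 𝕜 N := f.mkContinuous C fun y => hf y _ fun j => by
    simpa using SchreierCore.sum_le_norm y (singleton_mem_schreierFamily N j)
  let T := g.extend (UniformSpace.Completion.toComplL : SchreierCore 𝕜 N →L[𝕜] SchreierSpace 𝕜 N)
  have hT : ∀ y : SchreierCore 𝕜 N, T y = f y := fun y =>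
    ContinuousLinearMap.extend_eq _ denseRange_coe
      (UniformSpace.Completion.isUniformInducing_coe _) y
  refine ⟨T, C, hC, fun n => ?_, fun J hJ x b hb => ?_⟩
  · rw [basis, hT]
    show Finsupp.linearCombination 𝕜 e (Finsupp.single n 1) = e n
    rw [Finsupp.linearCombination_single, one_smul]
  · set R := T ∘L proj 𝕜 N J
    have hb0 : 0 ≤ b := (norm_nonneg _).trans (hb _ hJ.some_mem)
    have key : ∀ δ > 0, ‖R x‖ ≤ C * b + (‖R‖ + C) * δ := by
      intro δ hδ
      obtain ⟨y, hy⟩ := exists_core_near x hδ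
      have h1 : ‖R y‖ ≤ C * (b + δ) := by
        show ‖T (proj 𝕜 N J y)‖ ≤ _
        rw [proj_coe, hT]
        refine hf _ _ fun j => ?_
        rw [coord_proj_core]
        split_ifs with hj
        · have h2 := norm_le_insert' (coord 𝕜 N j y) (coord 𝕜 N j x)
          rw [← map_sub, coord_coe] at h2
          have h3 := norm_coord_le ((y : SchreierSpace 𝕜 N) - x) j
          rw [norm_sub_rev (y : SchreierSpace 𝕜 N) x] at h3
          linarith [hb j hj]
        · rw [norm_zero]
          positivity
      have h4 : ‖R x‖ ≤ ‖R y‖ + ‖R (x - y)‖ := by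
        rw [map_sub]
        exact norm_le_insert' _ _
      have h5 : ‖R (x - y)‖ ≤ ‖R‖ * δ := (R.le_opNorm _).trans (by gcongr)
      linarith
    have hRC : 0 < ‖R‖ + C := by positivity
    refine le_of_forall_pos_le_add fun ε hε => ?_
    have := key (ε / (‖R‖ + C)) (by positivity)
    rwa [mul_div_cancel₀ _ hRC.ne'] at this

/-- For a rapid sequence `x`, the vectors `∑ x_k(n) ẽ_n` are equivalent to the unit vector basis of
`c₀`. -/
theorem exists_isNormalizedC0Sequence (hN : 1 ≤ N) :
    ∃ e : ℕ+ → SchreierSpace 𝕜 N, IsNormalizedC0Sequence 𝕜 e := by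
  classical
  obtain ⟨M, rfl⟩ := Nat.exists_eq_add_of_le' hN
  obtain ⟨p, x, hx⟩ := exists_isRapid M
  let u : ℕ → SchreierSpace 𝕜 (M + 1) := fun k =>
    ∑ n ∈ (x k).support, (x k n : 𝕜) • basis 𝕜 (M + 1) n
  have hu : ∀ k n, coord 𝕜 (M + 1) n (u k) = (x k n : 𝕜) := by
    intro k n
    simp only [u]
    rw [coord_sum_smul_basis]
    split_ifs with h
    · rfl
    · rw [Finsupp.notMem_support_iff.mp h, RCLike.ofReal_zero]
  have hnu : ∀ k n, ‖coord 𝕜 (M + 1) n (u k)‖ = x k n := by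
    intro k n
    rw [hu, RCLike.norm_ofReal, abs_of_nonneg ((hx.average k).nonneg n)]
  have hdisj : ∀ k l n, n ∈ (x k).support → l ≠ k → x l n = 0 := by
    intro k l n hn hlk
    by_contra hl
    have hl := Finsupp.mem_support_iff.mpr hl
    have h1 := (hx.average k).lt n hn
    have h2 := (hx.average l).lt n hl
    have h3 := hx.le k n hn
    have h4 := hx.le l n hl
    rcases lt_or_gt_of_ne hlk with h | h
    · have : p (l + 1) ≤ p k := hx.mono h
      lia
    · have : p (k + 1) ≤ p l := hx.mono h
      lia
  refine ⟨fun n => u n.natPred, fun n => le_antisymm (norm_le_of_coord _ fun F _ => ?_) ?_,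
    1, 2, one_pos, fun a => ⟨?_, norm_le_of_coord _ fun F hF => ?_⟩⟩
  · simp only [hnu]
    exact (hx.average _).sum_le_one F
  · have h1 := sum_norm_coord_le (u n.natPred) (hx.average n.natPred).support_mem
    simp only [hnu] at h1
    rwa [(hx.average _).sum_eq] at h1
  · rw [one_mul]
    refine ciSup_le fun n => ?_
    -- test the norm on the support of the `n`-th average
    have h1 := sum_norm_coord_le (a.sum fun n t => t • u n.natPred)
      (hx.average n.natPred).support_mem
    refine le_trans (le_of_eq ?_) h1
    have h2 : ∀ m ∈ (x n.natPred).support,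
        ‖coord 𝕜 (M + 1) m (a.sum fun n t => t • u n.natPred)‖ = ‖a n‖ * x n.natPred m := by
      intro m hm
      rw [Finsupp.sum, map_sum, Finset.sum_eq_single n]
      · rw [map_smul, smul_eq_mul, norm_mul, hnu]
      · intro l _ hl
        rw [map_smul, hu, hdisj _ _ m hm fun h => hl (PNat.natPred_injective h),
          RCLike.ofReal_zero, smul_zero]
      · intro hn
        rw [Finsupp.notMem_support_iff.mp hn, zero_smul, map_zero]
    rw [Finset.sum_congr rfl h2, ← Finset.mul_sum, (hx.average _).sum_eq, mul_one]
  · have hbdd : BddAbove (Set.range fun n => ‖a n‖) :=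
      (Set.Finite.subset ((a.support.image fun n => ‖a n‖) ∪ {0}).finite_toSet (by
        rintro _ ⟨n, rfl⟩
        by_cases hn : n ∈ a.support
        · exact Finset.mem_coe.mpr (Finset.mem_union_left _ (Finset.mem_image_of_mem _ hn))
        · simp [Finsupp.notMem_support_iff.mp hn])).bddAbove
    have hs : ∀ n, ‖a n‖ ≤ ⨆ n, ‖a n‖ := le_ciSup hbdd
    have hs0 : 0 ≤ ⨆ n, ‖a n‖ := (norm_nonneg _).trans (hs 1)
    have h1 : ∀ m, ‖coord 𝕜 (M + 1) m (a.sum fun n t => t • u n.natPred)‖ ≤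
        (⨆ n, ‖a n‖) * ∑ n ∈ a.support, x n.natPred m := by
      intro m
      rw [Finsupp.sum, map_sum, Finset.mul_sum]
      refine norm_sum_le_of_le _ fun n _ => ?_
      rw [map_smul, smul_eq_mul, norm_mul, hnu]
      exact mul_le_mul_of_nonneg_right (hs n) ((hx.average _).nonneg m)
    have h2 : ∑ n ∈ a.support, ∑ m ∈ F, x n.natPred m ≤ 2 := by
      obtain ⟨K, hK⟩ : ∃ K, a.support.image PNat.natPred ⊆ Finset.range K :=
        (a.support.image PNat.natPred).exists_nat_subset_range
      calc ∑ n ∈ a.support, ∑ m ∈ F, x n.natPred m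
          = ∑ k ∈ a.support.image PNat.natPred, ∑ m ∈ F, x k m := by
            rw [Finset.sum_image fun n _ m _ h => PNat.natPred_injective h]
        _ ≤ ∑ k ∈ Finset.range K, ∑ m ∈ F, x k m :=
            Finset.sum_le_sum_of_subset_of_nonneg hK fun k _ _ =>
              Finset.sum_nonneg fun m _ => (hx.average k).nonneg m
        _ ≤ 2 := hx.sum_sum_le hF K
    calc _ ≤ ∑ m ∈ F, (⨆ n, ‖a n‖) * ∑ n ∈ a.support, x n.natPred m :=
          Finset.sum_le_sum fun m _ => h1 m
      _ = (⨆ n, ‖a n‖) * ∑ n ∈ a.support, ∑ m ∈ F, x n.natPred m := by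
          rw [← Finset.mul_sum, Finset.sum_comm]
      _ ≤ 2 * ⨆ n, ‖a n‖ := by
          rw [mul_comm]
          gcongr

end SchreierSpace

end

/-! ### A closed ideal of strictly singular operators -/

section StrictlySingular

variable {𝕜 : Type*} [RCLike 𝕜] {X : Type*} [NormedAddCommGroup X] [NormedSpace 𝕜 X]

theorem not_finiteDimensional_inf_ker {Z : Submodule 𝕜 X} (hZ : ¬ FiniteDimensional 𝕜 Z)
    {W : Type*} [AddCommGroup W] [Module 𝕜 W] (f : X →ₗ[𝕜] W)
    (hf : FiniteDimensional 𝕜 (Z.map f)) :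
    ¬ FiniteDimensional 𝕜 (Z ⊓ LinearMap.ker f : Submodule 𝕜 X) := fun h =>
  hZ <| (Submodule.fg_iff_finiteDimensional _).mp <| Submodule.fg_of_fg_map_of_fg_inf_ker f
    ((Submodule.fg_iff_finiteDimensional _).mpr hf) ((Submodule.fg_iff_finiteDimensional _).mpr h)

variable (𝕜 X) in
/-- The operators which are of arbitrarily small norm on a further infinite-dimensional subspace of
every infinite-dimensional subspace. In contrast to strict singularity, this condition is visibly
stable under sums. -/
def hereditarilySmallOperators : Submodule 𝕜 (X →L[𝕜] X) where
  carrier := {R | ∀ Z : Submodule 𝕜 X, ¬ FiniteDimensional 𝕜 Z → ∀ ε : ℝ, 0 < ε →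
    ∃ Z' ≤ Z, ¬ FiniteDimensional 𝕜 Z' ∧ ∀ z ∈ Z', ‖R z‖ ≤ ε * ‖z‖}
  zero_mem' Z hZ ε hε := ⟨Z, le_rfl, hZ, fun z _ => by
    rw [zero_apply, norm_zero]
    positivity⟩
  add_mem' := by
    intro R S hR hS Z hZ ε hε
    obtain ⟨Z₁, h1, hZ1, hR1⟩ := hR Z hZ (ε / 2) (half_pos hε)
    obtain ⟨Z₂, h2, hZ2, hS2⟩ := hS Z₁ hZ1 (ε / 2) (half_pos hε)
    refine ⟨Z₂, h2.trans h1, hZ2, fun z hz => (norm_add_le (R z) (S z)).trans ?_⟩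
    linarith [hR1 z (h2 hz), hS2 z hz]
  smul_mem' := by
    intro c R hR Z hZ ε hε
    have hc : 0 < ‖c‖ + 1 := by positivity
    obtain ⟨Z', h1, hZ1, hR1⟩ := hR Z hZ (ε / (‖c‖ + 1)) (by positivity)
    refine ⟨Z', h1, hZ1, fun z hz => ?_⟩
    rw [smul_apply, norm_smul]
    calc ‖c‖ * ‖R z‖ ≤ (‖c‖ + 1) * (ε / (‖c‖ + 1) * ‖z‖) :=
          mul_le_mul (by linarith) (hR1 z hz) (norm_nonneg _) hc.le
      _ = ε * ‖z‖ := by field_simp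

theorem mem_hereditarilySmallOperators {R : X →L[𝕜] X} :
    R ∈ hereditarilySmallOperators 𝕜 X ↔ ∀ Z : Submodule 𝕜 X, ¬ FiniteDimensional 𝕜 Z →
      ∀ ε : ℝ, 0 < ε → ∃ Z' ≤ Z, ¬ FiniteDimensional 𝕜 Z' ∧ ∀ z ∈ Z', ‖R z‖ ≤ ε * ‖z‖ :=
  Iff.rfl

theorem isSmallClosedIdeal_hereditarilySmallOperators :
    IsSmallClosedIdeal (hereditarilySmallOperators 𝕜 X) where
  finiteRank_mem R hR Z hZ ε hε := by
    refine ⟨Z ⊓ LinearMap.ker (R : X →ₗ[𝕜] X), inf_le_left,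
      not_finiteDimensional_inf_ker hZ _ ?_, fun z hz => ?_⟩
    · exact Submodule.finiteDimensional_of_le (S₂ := LinearMap.range (R : X →ₗ[𝕜] X))
        LinearMap.map_le_range
    · have : R z = 0 := hz.2
      rw [this, norm_zero]
      positivity
  comp_mem_left S R hR Z hZ ε hε := by
    have hS : 0 < ‖S‖ + 1 := by positivity
    obtain ⟨Z', h1, hZ1, hR1⟩ := hR Z hZ (ε / (‖S‖ + 1)) (by positivity)
    refine ⟨Z', h1, hZ1, fun z hz => ?_⟩
    calc ‖S (R z)‖ ≤ ‖S‖ * ‖R z‖ := S.le_opNorm _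
      _ ≤ (‖S‖ + 1) * (ε / (‖S‖ + 1) * ‖z‖) :=
          mul_le_mul (by linarith) (hR1 z hz) (norm_nonneg _) hS.le
      _ = ε * ‖z‖ := by field_simp
  comp_mem_right S R hR Z hZ ε hε := by
    by_cases hfin : FiniteDimensional 𝕜 (Z.map (S : X →ₗ[𝕜] X))
    · refine ⟨_, inf_le_left, not_finiteDimensional_inf_ker hZ _ hfin, fun z hz => ?_⟩
      have : S z = 0 := hz.2
      rw [ContinuousLinearMap.comp_apply, this, map_zero, norm_zero]
      positivity
    · have hS : 0 < ‖S‖ + 1 := by positivity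
      obtain ⟨Z', h1, hZ1, hR1⟩ := hR _ hfin (ε / (‖S‖ + 1)) (by positivity)
      refine ⟨Z ⊓ Z'.comap (S : X →ₗ[𝕜] X), inf_le_left, fun h => hZ1 ?_, fun z hz => ?_⟩
      · have hle : Z' ≤ (Z ⊓ Z'.comap (S : X →ₗ[𝕜] X)).map (S : X →ₗ[𝕜] X) := by
          intro w hw
          obtain ⟨z, hz, rfl⟩ := h1 hw
          exact ⟨z, ⟨hz, hw⟩, rfl⟩
        exact Submodule.finiteDimensional_of_le hle
      · calc ‖R (S z)‖ ≤ ε / (‖S‖ + 1) * ‖S z‖ := hR1 _ hz.2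
          _ ≤ ε / (‖S‖ + 1) * ((‖S‖ + 1) * ‖z‖) := by
              gcongr
              exact (S.le_opNorm z).trans (by gcongr; linarith)
          _ = ε * ‖z‖ := by field_simp
  isClosed := by
    refine isClosed_of_closure_subset fun R hR Z hZ ε hε => ?_
    obtain ⟨R', hR', hd⟩ := Metric.mem_closure_iff.mp hR (ε / 2) (half_pos hε)
    obtain ⟨Z', h1, hZ1, h2⟩ := hR' Z hZ (ε / 2) (half_pos hε)
    refine ⟨Z', h1, hZ1, fun z hz => ?_⟩
    rw [dist_eq_norm] at hd
    have h3 : ‖(R - R') z‖ ≤ ε / 2 * ‖z‖ := ((R - R').le_opNorm z).trans (by gcongr)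
    have h4 : ‖R z‖ ≤ ‖R' z‖ + ‖R z - R' z‖ := norm_le_insert' _ _
    rw [sub_apply] at h3
    linarith [h2 z hz]
  strictlySingular R hR Z hZ := by
    rintro ⟨c, hc, h⟩
    obtain ⟨Z', h1, hZ1, h2⟩ := hR Z hZ (c / 2) (half_pos hc)
    refine hZ1 ?_
    have h3 : Z' = ⊥ := by
      rw [Submodule.eq_bot_iff]
      intro z hz
      rw [← norm_le_zero_iff]
      nlinarith [h z (h1 hz), h2 z hz, norm_nonneg z]
    rw [h3]
    infer_instance

theorem closedIdealSpan_le {B : Set (X →L[𝕜] X)} {I : Submodule 𝕜 (X →L[𝕜] X)}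
    (hI : IsClosedOperatorIdeal I) (hB : B ⊆ I) : closedIdealSpan B ≤ I :=
  sInf_le ⟨hI, hB⟩

theorem subset_closedIdealSpan (B : Set (X →L[𝕜] X)) :
    B ⊆ (closedIdealSpan B : Set (X →L[𝕜] X)) := fun _ hT =>
  Submodule.mem_sInf.mpr fun _ hI => hI.2 hT

theorem closedIdealSpan_mono {B B' : Set (X →L[𝕜] X)} (h : B ⊆ B') :
    closedIdealSpan B ≤ closedIdealSpan B' :=
  closedIdealSpan_le (isClosedOperatorIdeal_closedIdealSpan B') (h.trans (subset_closedIdealSpan B'))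

end StrictlySingular

/-! ### Auxiliary facts for gliding humps -/

theorem mem_schreierFamily_of_subset {M : ℕ} {F G : Finset ℕ+} (hF : F ∈ schreierFamily M)
    (hG : G ⊆ F) : G ∈ schreierFamily M := by
  classical
  induction M generalizing F G with
  | zero =>
    rcases hF with rfl | ⟨n, rfl⟩
    · exact Or.inl (Finset.subset_empty.mp hG)
    · rcases Finset.subset_singleton_iff.mp hG with h | h
      · exact Or.inl h
      · exact Or.inr ⟨n, h⟩
  | succ M ih =>
    obtain ⟨k, E, hE, hk, hlt, rfl⟩ := hF
    refine ⟨k, fun i => E i ∩ G, fun i => ih (hE i) Finset.inter_subset_left,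
      fun i n hn => hk i n (Finset.mem_inter.mp hn).1,
      fun i j hij m hm n hn => hlt i j hij m (Finset.mem_inter.mp hm).1 n (Finset.mem_inter.mp hn).1,
      ?_⟩
    ext n
    have := @hG n
    simp only [Finset.mem_biUnion, Finset.mem_univ, true_and, Finset.mem_inter] at this ⊢
    tauto

theorem sum_half_pow_le_of_finset (s : Finset ℕ) : ∑ k ∈ s, (1 / 2 : ℝ) ^ (k + 1) ≤ 1 := by
  obtain ⟨K, hK⟩ := s.exists_nat_subset_range
  exact (Finset.sum_le_sum_of_subset_of_nonneg hK fun _ _ _ => by positivity).trans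
    (sum_half_pow_le K)

theorem sum_ite_Ioc_le_one {p : ℕ → ℕ} (hp : Monotone p) (n K : ℕ) :
    ∑ k ∈ Finset.range K, (if p k < n ∧ n ≤ p (k + 1) then (1 : ℝ) else 0) ≤ 1 := by
  rw [Finset.sum_boole]
  norm_cast
  refine Finset.card_le_one.mpr fun k hk l hl => ?_
  simp only [Finset.mem_filter] at hk hl
  by_contra hkl
  rcases lt_or_gt_of_ne hkl with h | h
  · have : p (k + 1) ≤ p l := hp h
    lia
  · have : p (l + 1) ≤ p k := hp h
    lia

theorem exists_norm_eq_one_mem {𝕜 : Type*} [RCLike 𝕜] {X : Type*} [NormedAddCommGroup X]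
    [NormedSpace 𝕜 X] {Z : Submodule 𝕜 X} (hZ : ¬ FiniteDimensional 𝕜 Z) :
    ∃ z ∈ Z, ‖z‖ = 1 := by
  have h0 : Z ≠ ⊥ := by
    rintro rfl
    exact hZ inferInstance
  obtain ⟨z, hz, hz0⟩ := Z.exists_mem_ne_zero_of_ne_bot h0
  exact ⟨((‖z‖ : 𝕜)⁻¹) • z, Z.smul_mem _ hz, norm_smul_inv_norm hz0⟩

/-! ### Operators bounded by the supremum norm are hereditarily small -/

namespace SchreierSpace

variable {𝕜 : Type*} [RCLike 𝕜] {N : ℕ}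

theorem exists_mem_vanishing {Z : Submodule 𝕜 (SchreierSpace 𝕜 N)}
    (hZ : ¬ FiniteDimensional 𝕜 Z) (p : ℕ) :
    ∃ Z' ≤ Z, ¬ FiniteDimensional 𝕜 Z' ∧
      ∀ z ∈ Z', ∀ n : ℕ+, (n : ℕ) ≤ p → coord 𝕜 N n z = 0 := by
  let f : SchreierSpace 𝕜 N →ₗ[𝕜] (Fin p → 𝕜) :=
    LinearMap.pi fun i => (coord 𝕜 N i.1.succPNat : SchreierSpace 𝕜 N →ₗ[𝕜] 𝕜)
  refine ⟨_, inf_le_left, not_finiteDimensional_inf_ker hZ f inferInstance, fun z hz n hn => ?_⟩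
  have h1 : f z = 0 := hz.2
  have h2 := congrFun h1 ⟨n.natPred, by have := n.natPred_add_one; lia⟩
  simpa [f] using h2

/-- If the norm were equivalent to the supremum norm on `Z`, then one could choose normalized, almost
disjointly supported vectors whose coordinates `j_k` are bounded below. Their sums would be bounded,
but the norm of the sum of `m` of them, tested on the set of the `m` coordinates `j_k`, which
belongs to `S_1 ⊆ S_N` if it starts after `m`, is of order `m`. -/
theorem exists_norm_coord_le {Z : Submodule 𝕜 (SchreierSpace 𝕜 N)} (hN : 1 ≤ N)
    (hZ : ¬ FiniteDimensional 𝕜 Z) {η : ℝ} (hη : 0 < η) :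
    ∃ z ∈ Z, ‖z‖ = 1 ∧ ∀ n, ‖coord 𝕜 N n z‖ ≤ η := by
  classical
  by_contra! H
  have H' : ∀ z ∈ Z, ∀ b, (∀ n, ‖coord 𝕜 N n z‖ ≤ b) → η * ‖z‖ ≤ b := by
    intro z hz b hb
    rcases eq_or_ne z 0 with rfl | h0
    · simpa using hb 1
    · have hz0 : 0 < ‖z‖ := norm_pos_iff.mpr h0
      obtain ⟨n, hn⟩ := H (((‖z‖ : 𝕜)⁻¹) • z) (Z.smul_mem _ hz) (norm_smul_inv_norm h0)
      rw [map_smul, norm_smul, norm_inv, RCLike.norm_ofReal, abs_norm, inv_mul_eq_div,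
        lt_div_iff₀ hz0] at hn
      exact hn.le.trans (hb n)
  obtain ⟨m, hm⟩ := exists_nat_gt ((1 + η / 2) / (η * (η / 2)))
  have hm0 : 0 < m := by
    have : (0 : ℝ) < m := lt_of_le_of_lt (by positivity) hm
    exact_mod_cast this
  obtain ⟨p, z, hp0, hmono, hP⟩ := exists_gliding_seq
    (fun k p z q => z ∈ Z ∧ ‖z‖ = 1 ∧ (∀ n : ℕ+, (n : ℕ) ≤ p → coord 𝕜 N n z = 0) ∧
      (∃ j : ℕ+, (j : ℕ) ≤ q ∧ η < ‖coord 𝕜 N j z‖) ∧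
      ∀ n : ℕ+, q < (n : ℕ) → ‖coord 𝕜 N n z‖ ≤ η / 2 * (1 / 2) ^ (k + 1))
    (fun k p _ => by
      obtain ⟨Z', hZ', hfin, hv⟩ := exists_mem_vanishing hZ p
      obtain ⟨z, hz, hz1⟩ := exists_norm_eq_one_mem hfin
      obtain ⟨j, hj⟩ := H z (hZ' hz) hz1
      obtain ⟨q, hq⟩ := exists_tail_le z (ε := η / 2 * (1 / 2) ^ (k + 1)) (by positivity)
      refine ⟨z, max p (max j q), le_max_left _ _, hZ' hz, hz1, hv z hz,
        ⟨j, by simp, hj⟩, fun n hn => ?_⟩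
      simpa using hq {n} (singleton_mem_schreierFamily N n) (by simp at hn ⊢; tauto)) m hm0
  choose hzZ hz1 hzv hj hzt using hP
  choose j hjle hj using hj
  have hpj : ∀ k, p k < j k := by
    intro k
    by_contra! hk
    have := hj k
    rw [hzv k (j k) hk, norm_zero] at this
    linarith
  have hjmono : StrictMono j := fun k l hkl =>
    PNat.coe_lt_coe _ _ |>.mp ((hjle k).trans_lt ((hmono hkl).trans_lt (hpj l)))
  set w := ∑ k ∈ Finset.range m, z k
  have hw : w ∈ Z := Z.sum_mem fun k _ => hzZ k
  have hwle : ∀ n, ‖coord 𝕜 N n w‖ ≤ 1 + η / 2 := by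
    intro n
    rw [map_sum]
    calc _ ≤ ∑ k ∈ Finset.range m,
          ((if p k < n ∧ n ≤ p (k + 1) then 1 else 0) + η / 2 * (1 / 2) ^ (k + 1)) := by
          refine norm_sum_le_of_le _ fun k _ => ?_
          have hpos : 0 ≤ η / 2 * (1 / 2) ^ (k + 1) := by positivity
          split_ifs with hk
          · linarith [norm_coord_le (z k) n, hz1 k]
          · rw [not_and_or, not_lt, not_le] at hk
            rw [zero_add]
            rcases hk with hk | hk
            · rwa [hzv k n hk, norm_zero]
            · exact hzt k n hk
      _ ≤ 1 + η / 2 * 1 := by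
          rw [Finset.sum_add_distrib, ← Finset.mul_sum]
          exact add_le_add (sum_ite_Ioc_le_one hmono _ _)
            (mul_le_mul_of_nonneg_left (sum_half_pow_le _) (by positivity))
      _ = 1 + η / 2 := by ring
  have hwge : ∀ i ∈ Finset.range m, η / 2 ≤ ‖coord 𝕜 N (j i) w‖ := by
    intro i hi
    have h1 : coord 𝕜 N (j i) w = coord 𝕜 N (j i) (z i) +
        ∑ k ∈ (Finset.range m).erase i, coord 𝕜 N (j i) (z k) := by
      rw [map_sum]
      exact (Finset.add_sum_erase _ (fun k => coord 𝕜 N (j i) (z k)) hi).symm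
    have h2 : ‖∑ k ∈ (Finset.range m).erase i, coord 𝕜 N (j i) (z k)‖ ≤ η / 2 := by
      calc _ ≤ ∑ k ∈ (Finset.range m).erase i, η / 2 * (1 / 2) ^ (k + 1) := by
            refine norm_sum_le_of_le _ fun k hk => ?_
            rcases lt_or_gt_of_ne (Finset.ne_of_mem_erase hk) with h | h
            · exact hzt k _ ((hmono h).trans_lt (hpj i))
            · rw [hzv k _ ((hjle i).trans (hmono h)), norm_zero]
              positivity
        _ ≤ ∑ k ∈ Finset.range m, η / 2 * (1 / 2) ^ (k + 1) :=
            Finset.sum_le_sum_of_subset_of_nonneg (Finset.erase_subset _ _)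
              fun _ _ _ => by positivity
        _ ≤ η / 2 * 1 := by
            rw [← Finset.mul_sum]
            exact mul_le_mul_of_nonneg_left (sum_half_pow_le _) (by positivity)
        _ = η / 2 := mul_one _
    rw [h1]
    have h3 := norm_sub_le_norm_add (coord 𝕜 N (j i) (z i))
      (∑ k ∈ (Finset.range m).erase i, coord 𝕜 N (j i) (z k))
    linarith [hj i]
  have hF : (Finset.range m).image j ∈ schreierFamily N := by
    obtain ⟨M, rfl⟩ := Nat.exists_eq_add_of_le' hN
    refine mem_schreierFamily_of_card_le M fun n hn => ?_
    obtain ⟨k, -, rfl⟩ := Finset.mem_image.mp hn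
    refine Finset.card_image_le.trans ?_
    rw [Finset.card_range]
    have := hmono (Nat.zero_le k)
    have := hpj k
    lia
  have hnw : m * (η / 2) ≤ ‖w‖ := by
    refine le_trans ?_ (sum_norm_coord_le w hF)
    rw [Finset.sum_image fun a _ b _ h => hjmono.injective h]
    simpa using Finset.card_nsmul_le_sum _ _ _ hwge
  have h5 := H' w hw _ hwle
  rw [div_lt_iff₀ (by positivity)] at hm
  nlinarith

/-- A gliding hump: the `z_k ∈ Z` are normalized, supported after `p k`, nearly normed by their
coordinates in `(p k, p (k + 1)]`, and their supremum norms are so small that the supremum norm is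
small on their whole span. -/
theorem IsSupBounded.mem_hereditarilySmallOperators (hN : 1 ≤ N)
    {R : SchreierSpace 𝕜 N →L[𝕜] SchreierSpace 𝕜 N} {J : Set ℕ+} {C : ℝ} (hC : 0 < C)
    (h : IsSupBounded R J C) : R ∈ hereditarilySmallOperators 𝕜 (SchreierSpace 𝕜 N) := by
  classical
  intro Z hZ ε hε
  obtain ⟨p, z, -, hmono, hP⟩ := exists_gliding_seq
    (fun k p z q => z ∈ Z ∧ (∀ n : ℕ+, (n : ℕ) ≤ p → coord 𝕜 N n z = 0) ∧
      (∀ n : ℕ+, ‖coord 𝕜 N n z‖ ≤ ε / C / 2 * (1 / 2) ^ (k + 1)) ∧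
      (∃ F ∈ schreierFamily N, (∀ n ∈ F, p < (n : ℕ) ∧ (n : ℕ) ≤ q) ∧
        3 / 4 ≤ ∑ n ∈ F, ‖coord 𝕜 N n z‖) ∧
      ∀ F ∈ schreierFamily N, (∀ n ∈ F, q < (n : ℕ)) →
        ∑ n ∈ F, ‖coord 𝕜 N n z‖ ≤ 1 / 4 * (1 / 2) ^ (k + 1))
    (fun k p _ => by
      obtain ⟨Z', hZ', hfin, hv⟩ := exists_mem_vanishing hZ p
      obtain ⟨z, hz, hz1, hzs⟩ := exists_norm_coord_le hN hfin
        (η := ε / C / 2 * (1 / 2) ^ (k + 1)) (by positivity)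
      obtain ⟨F, hF, hnorming⟩ := exists_norming z (ε := 1 / 4) (by norm_num)
      obtain ⟨q, hq⟩ := exists_tail_le z (ε := 1 / 4 * (1 / 2) ^ (k + 1)) (by positivity)
      refine ⟨z, max p (max (F.sup fun n => (n : ℕ)) q), le_max_left _ _, hZ' hz, hv z hz, hzs,
        ⟨F.filter fun n => p < (n : ℕ), mem_schreierFamily_of_subset hF (Finset.filter_subset _ _),
          fun n hn => ?_, ?_⟩, fun G hG hn => hq G hG fun n h => ?_⟩
      · rw [Finset.mem_filter] at hn
        exact ⟨hn.2, (Finset.le_sup (f := fun n : ℕ+ => (n : ℕ)) hn.1).trans (by simp)⟩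
      · rw [Finset.sum_filter_of_ne fun n _ hn => ?_]
        · linarith
        · by_contra! hnp
          exact hn (by rw [hv z hz n hnp, norm_zero])
      · have := hn n h
        simp at this
        tauto) 1 le_rfl
  choose hzZ hzv hzs hF hzt using hP
  choose F hF hFp hzF using hF
  -- `A` is the largest modulus of a coefficient of `w`, attained at the index `k`
  have key : ∀ a : ℕ →₀ 𝕜, a ≠ 0 → ∃ A : ℝ, 0 < A ∧
      A / 2 ≤ ‖Finsupp.linearCombination 𝕜 z a‖ ∧
      ∀ n, ‖coord 𝕜 N n (Finsupp.linearCombination 𝕜 z a)‖ ≤ ε / C * (A / 2) := by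
    intro a ha
    obtain ⟨k, hk, hmax⟩ := Finset.exists_max_image a.support (fun k => ‖a k‖)
      (Finsupp.support_nonempty_iff.mpr ha)
    have hA : 0 < ‖a k‖ := norm_pos_iff.mpr (Finsupp.mem_support_iff.mp hk)
    have hw : ∀ n, coord 𝕜 N n (Finsupp.linearCombination 𝕜 z a) =
        ∑ l ∈ a.support, a l * coord 𝕜 N n (z l) := by
      intro n
      simp [Finsupp.linearCombination_apply, Finsupp.sum, map_sum]
    refine ⟨‖a k‖, hA, ?_, fun n => ?_⟩
    · refine le_trans ?_ (sum_norm_coord_le _ (hF k))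
      have h1 : ∀ n, ‖a k‖ * ‖coord 𝕜 N n (z k)‖ -
          ∑ l ∈ a.support.erase k, ‖a k‖ * ‖coord 𝕜 N n (z l)‖ ≤
          ‖coord 𝕜 N n (Finsupp.linearCombination 𝕜 z a)‖ := by
        intro n
        rw [hw, ← Finset.add_sum_erase _ _ hk, ← norm_mul]
        refine le_trans (sub_le_sub_left (norm_sum_le_of_le (f := fun l => a l * coord 𝕜 N n (z l))
          _ fun l hl => ?_) _) (norm_sub_le_norm_add _ _)
        rw [norm_mul]
        exact mul_le_mul_of_nonneg_right (hmax l (Finset.mem_of_mem_erase hl)) (norm_nonneg _)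
      have h2 : ∀ l ∈ a.support.erase k, ∑ n ∈ F k, ‖coord 𝕜 N n (z l)‖ ≤
          1 / 4 * (1 / 2) ^ (l + 1) := by
        intro l hl
        rcases lt_or_gt_of_ne (Finset.ne_of_mem_erase hl) with h | h
        · exact hzt l _ (hF k) fun n hn => (hmono h).trans_lt (hFp k n hn).1
        · rw [Finset.sum_eq_zero fun n hn => ?_]
          · positivity
          · rw [hzv l n ((hFp k n hn).2.trans (hmono h)), norm_zero]
      have h3 : ∑ l ∈ a.support.erase k, ∑ n ∈ F k, ‖coord 𝕜 N n (z l)‖ ≤ 1 / 4 := by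
        refine (Finset.sum_le_sum h2).trans ?_
        rw [← Finset.mul_sum]
        linarith [sum_half_pow_le_of_finset (a.support.erase k)]
      calc ‖a k‖ / 2 ≤ ‖a k‖ * ∑ n ∈ F k, ‖coord 𝕜 N n (z k)‖ -
            ‖a k‖ * ∑ l ∈ a.support.erase k, ∑ n ∈ F k, ‖coord 𝕜 N n (z l)‖ := by
            nlinarith [hzF k]
        _ = ∑ n ∈ F k, (‖a k‖ * ‖coord 𝕜 N n (z k)‖ -
            ∑ l ∈ a.support.erase k, ‖a k‖ * ‖coord 𝕜 N n (z l)‖) := by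
            rw [Finset.sum_sub_distrib, Finset.sum_comm]
            simp only [Finset.mul_sum]
        _ ≤ _ := Finset.sum_le_sum fun n _ => h1 n
    · rw [hw]
      calc _ ≤ ∑ l ∈ a.support, ‖a k‖ * (ε / C / 2 * (1 / 2) ^ (l + 1)) := by
            refine norm_sum_le_of_le _ fun l hl => ?_
            rw [norm_mul]
            exact mul_le_mul (hmax l hl) (hzs l n) (norm_nonneg _) hA.le
        _ = ‖a k‖ * (ε / C / 2) * ∑ l ∈ a.support, (1 / 2 : ℝ) ^ (l + 1) := by
            rw [Finset.mul_sum]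
            exact Finset.sum_congr rfl fun l _ => by ring
        _ ≤ ‖a k‖ * (ε / C / 2) * 1 :=
            mul_le_mul_of_nonneg_left (sum_half_pow_le_of_finset _) (by positivity)
        _ = ε / C * (‖a k‖ / 2) := by ring
  refine ⟨Submodule.span 𝕜 (Set.range z), Submodule.span_le.mpr ?_, fun hfin => ?_,
    fun w hw => ?_⟩
  · rintro _ ⟨k, rfl⟩
    exact hzZ k
  · have hli : LinearIndependent 𝕜 z := by
      rw [linearIndependent_iff]
      intro a ha
      by_contra h0
      obtain ⟨A, hA, h1, -⟩ := key a h0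
      rw [ha, norm_zero] at h1
      linarith
    have : Finite ℕ := (linearIndependent_span hli).finite_of_isNoetherian
    exact not_finite ℕ
  · obtain ⟨a, rfl⟩ := (Finsupp.mem_span_range_iff_exists_finsupp).mp hw
    rw [← Finsupp.linearCombination_apply]
    rcases eq_or_ne a 0 with rfl | h0
    · simp
    · obtain ⟨A, hA, h1, h2⟩ := key a h0
      calc _ ≤ C * (ε / C * (A / 2)) := h _ _ fun n _ => h2 n
        _ = ε * (A / 2) := by field_simp
        _ ≤ _ := by gcongr

end SchreierSpace

/-! ### A choice of signs -/

section Signs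

variable {𝕜 : Type*} [RCLike 𝕜]

theorem RCLike.exists_mul_eq_norm (z : 𝕜) : ∃ u : 𝕜, ‖u‖ ≤ 1 ∧ u * z = (‖z‖ : 𝕜) := by
  rcases eq_or_ne z 0 with rfl | hz
  · exact ⟨0, by simp, by simp⟩
  · have hz' : (‖z‖ : 𝕜) ≠ 0 := by simpa using hz
    refine ⟨(‖z‖ : 𝕜)⁻¹ * starRingEnd 𝕜 z, ?_, ?_⟩
    · simp [hz]
    · rw [mul_assoc, RCLike.conj_mul, sq, ← mul_assoc, inv_mul_cancel₀ hz', one_mul]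

/-- For vectors `z i` and a choice of one coordinate `φ i` of each of them there are unimodular (or
zero) coefficients for which the combination of the `z i` has an `ℓ₁`-norm, over the chosen
coordinates, at least the sum of all `|z i (φ i)|`. The coefficients are phases making the chosen
coordinates nonnegative, times signs depending on `φ i` only. The average over all signs satisfies
the inequality, since changing the sign belonging to `j` changes the `j`-th coordinate of the
combination by twice the sum of the `|z i j|` with `φ i = j`. -/
theorem exists_coeff_sum_norm_le {ι κ : Type*} [DecidableEq κ] (B : Finset ι) (φ : ι → κ)
    (z : ι → κ → 𝕜) :
    ∃ c : ι → 𝕜, (∀ i, ‖c i‖ ≤ 1) ∧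
      ∑ i ∈ B, ‖z i (φ i)‖ ≤ ∑ j ∈ B.image φ, ‖∑ i ∈ B, c i * z i j‖ := by
  choose u hu huz using fun i => RCLike.exists_mul_eq_norm (z i (φ i))
  let θ : Finset κ → κ → 𝕜 := fun S j => if j ∈ S then -1 else 1
  have hθ : ∀ S j, ‖θ S j‖ = 1 := by
    intro S j
    simp only [θ]
    split_ifs <;> simp
  let y : Finset κ → κ → 𝕜 := fun S j => ∑ i ∈ B, θ S (φ i) * u i * z i j
  have hflip : ∀ S j, 2 * ∑ i ∈ B with φ i = j, ‖z i (φ i)‖ ≤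
      ‖y S j‖ + ‖y (symmDiff S {j}) j‖ := by
    intro S j
    have h1 : y S j - y (symmDiff S {j}) j =
        2 * θ S j * ((∑ i ∈ B with φ i = j, ‖z i (φ i)‖ : ℝ) : 𝕜) := by
      simp only [y]
      rw [← Finset.sum_sub_distrib, Finset.sum_filter]
      push_cast
      rw [Finset.mul_sum]
      refine Finset.sum_congr rfl fun i _ => ?_
      split_ifs with h
      · subst h
        have : θ (symmDiff S {φ i}) (φ i) = -θ S (φ i) := by
          by_cases h : φ i ∈ S <;> simp [θ, h, Finset.mem_symmDiff]
        rw [this, mul_assoc, mul_assoc, huz]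
        ring
      · have : θ (symmDiff S {j}) (φ i) = θ S (φ i) := by
          simp [θ, h, Finset.mem_symmDiff]
        rw [this]
        simp
    have h2 := norm_sub_le (y S j) (y (symmDiff S {j}) j)
    rw [h1, norm_mul, norm_mul, hθ, RCLike.norm_ofReal, abs_of_nonneg (by positivity),
      RCLike.norm_ofNat, mul_one] at h2
    exact h2
  set F := B.image φ
  have hsum : ∀ j ∈ F, ∑ _S ∈ F.powerset, ∑ i ∈ B with φ i = j, ‖z i (φ i)‖ ≤
      ∑ S ∈ F.powerset, ‖y S j‖ := by
    intro j hj
    have h1 : ∑ S ∈ F.powerset, ‖y (symmDiff S {j}) j‖ = ∑ S ∈ F.powerset, ‖y S j‖ := by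
      have hmem : ∀ S ∈ F.powerset, symmDiff S {j} ∈ F.powerset := by
        intro S hS
        rw [Finset.mem_powerset] at hS ⊢
        intro l hl
        rcases Finset.mem_symmDiff.mp hl with h | h
        · exact hS h.1
        · rw [Finset.mem_singleton.mp h.1]
          exact hj
      exact Finset.sum_nbij' (fun S => symmDiff S {j}) (fun S => symmDiff S {j}) hmem hmem
        (fun S _ => symmDiff_symmDiff_cancel_right _ _)
        (fun S _ => symmDiff_symmDiff_cancel_right _ _) fun S _ => rfl
    have h2 := Finset.sum_le_sum fun S (_ : S ∈ F.powerset) => hflip S j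
    rw [Finset.sum_add_distrib, h1, ← Finset.mul_sum] at h2
    linarith
  have htotal : ∑ _S ∈ F.powerset, ∑ i ∈ B, ‖z i (φ i)‖ ≤
      ∑ S ∈ F.powerset, ∑ j ∈ F, ‖y S j‖ := by
    have h1 : ∑ i ∈ B, ‖z i (φ i)‖ = ∑ j ∈ F, ∑ i ∈ B with φ i = j, ‖z i (φ i)‖ :=
      (Finset.sum_fiberwise_of_maps_to (fun i hi => Finset.mem_image_of_mem φ hi) _).symm
    rw [h1, Finset.sum_comm, Finset.sum_comm (s := F.powerset)]
    exact Finset.sum_le_sum hsum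
  obtain ⟨S, -, hS⟩ := Finset.exists_le_of_sum_le (Finset.powerset_nonempty F) htotal
  refine ⟨fun i => θ S (φ i) * u i, fun i => ?_, hS⟩
  rw [norm_mul, hθ, one_mul]
  exact hu i

end Signs

/-! ### The ideal of operators that are null on averages -/

namespace SchreierSpace

open Filter Topology

variable {𝕜 : Type*} [RCLike 𝕜] {N : ℕ} {p : ℕ → ℕ} {x : ℕ → ℕ+ →₀ ℝ}

theorem _root_.IsRapid.norm_sum_le (hx : IsRapid N p x) (k : ℕ) {c : ℕ+ → 𝕜}
    (hc : ∀ n, ‖c n‖ ≤ 1) :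
    ‖∑ n ∈ (x k).support, (c n * (x k n : 𝕜)) • basis 𝕜 N n‖ ≤ (1 / 2) ^ (k + 1) / p k := by
  classical
  refine norm_le_of_coord _ fun F hF => le_trans (Finset.sum_le_sum fun n _ => ?_)
    ((hx.average k).small F hF)
  have h0 := (hx.average k).nonneg n
  rw [coord_sum_smul_basis (c := fun n => c n * (x k n : 𝕜))]
  split_ifs
  · rw [norm_mul, RCLike.norm_ofReal, abs_of_nonneg h0]
    exact mul_le_of_le_one_left h0 (hc n)
  · rwa [norm_zero]

theorem _root_.IsRapid.sum_mul_norm_le (hx : IsRapid N p x) (k : ℕ)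
    (f : SchreierSpace 𝕜 N →L[𝕜] 𝕜) :
    ∑ n ∈ (x k).support, x k n * ‖f (basis 𝕜 N n)‖ ≤ ‖f‖ * (1 / 2) ^ (k + 1) := by
  choose u hu huf using fun n => RCLike.exists_mul_eq_norm (f (basis 𝕜 N n))
  have hp : (1 : ℝ) ≤ p k := by exact_mod_cast hx.one_le k
  have h1 : f (∑ n ∈ (x k).support, (u n * (x k n : 𝕜)) • basis 𝕜 N n) =
      ((∑ n ∈ (x k).support, x k n * ‖f (basis 𝕜 N n)‖ : ℝ) : 𝕜) := by
    rw [map_sum]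
    push_cast
    refine Finset.sum_congr rfl fun n _ => ?_
    rw [map_smul, smul_eq_mul]
    linear_combination (x k n : 𝕜) * huf n
  have h2 : 0 ≤ ∑ n ∈ (x k).support, x k n * ‖f (basis 𝕜 N n)‖ :=
    Finset.sum_nonneg fun n _ => mul_nonneg ((hx.average k).nonneg n) (norm_nonneg _)
  calc _ = ‖f (∑ n ∈ (x k).support, (u n * (x k n : 𝕜)) • basis 𝕜 N n)‖ := by
        rw [h1, RCLike.norm_ofReal, abs_of_nonneg h2]
    _ ≤ ‖f‖ * ((1 / 2) ^ (k + 1) / p k) :=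
        (f.le_opNorm _).trans (mul_le_mul_of_nonneg_left (hx.norm_sum_le k hu) (norm_nonneg f))
    _ ≤ ‖f‖ * (1 / 2) ^ (k + 1) := by
        gcongr
        exact div_le_self (by positivity) hp

theorem tendsto_half_pow_of_le_atTop {L : Filter ℕ} (hL : L ≤ atTop) :
    Tendsto (fun k : ℕ => (1 / 2 : ℝ) ^ (k + 1)) L (𝓝 0) :=
  ((tendsto_pow_atTop_nhds_zero_of_lt_one (by norm_num) (by norm_num)).comp
    (tendsto_add_atTop_nat 1)).mono_left hL

/-- The operators `R` such that, for every operator `V`, the averages `∑_n x_k(n) ‖R V ẽ_n‖` tend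
to `0` as `k` tends to infinity along the filter `L`. -/
def averageNullOperators (hx : IsRapid N p x) (L : Filter ℕ) :
    Submodule 𝕜 (SchreierSpace 𝕜 N →L[𝕜] SchreierSpace 𝕜 N) where
  carrier := {R | ∀ V : SchreierSpace 𝕜 N →L[𝕜] SchreierSpace 𝕜 N,
    Tendsto (fun k => ∑ n ∈ (x k).support, x k n * ‖R (V (basis 𝕜 N n))‖) L (𝓝 0)}
  zero_mem' V := by simpa using tendsto_const_nhds
  add_mem' := by
    intro R S hR hS V
    have h := (hR V).add (hS V)
    rw [add_zero] at h
    refine squeeze_zero (fun k => ?_) (fun k => ?_) h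
    · exact Finset.sum_nonneg fun n _ => mul_nonneg ((hx.average k).nonneg n) (norm_nonneg _)
    · rw [← Finset.sum_add_distrib]
      refine Finset.sum_le_sum fun n _ => ?_
      rw [← mul_add]
      exact mul_le_mul_of_nonneg_left (norm_add_le _ _) ((hx.average k).nonneg n)
  smul_mem' := by
    intro c R hR V
    have h := (hR V).const_mul ‖c‖
    rw [mul_zero] at h
    refine h.congr fun k => ?_
    rw [Finset.mul_sum]
    refine Finset.sum_congr rfl fun n _ => ?_
    rw [smul_apply, norm_smul]
    ring

theorem isClosedOperatorIdeal_averageNullOperators (hx : IsRapid N p x) {L : Filter ℕ}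
    (hL : L ≤ atTop) :
    IsClosedOperatorIdeal (averageNullOperators (𝕜 := 𝕜) hx L) where
  finiteRank_mem R hR V := by
    let W := LinearMap.range (R : SchreierSpace 𝕜 N →ₗ[𝕜] SchreierSpace 𝕜 N)
    have : FiniteDimensional 𝕜 W := hR
    let b := Module.finBasis 𝕜 W
    let Q : SchreierSpace 𝕜 N →L[𝕜] W := R.codRestrict W fun v => ⟨v, rfl⟩
    let f := fun i => (LinearMap.toContinuousLinearMap (b.coord i)) ∘L Q ∘L V
    have hf : ∀ v, ‖R (V v)‖ ≤ ∑ i, ‖f i v‖ * ‖(b i : SchreierSpace 𝕜 N)‖ := by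
      intro v
      have h1 : R (V v) = ((∑ i, b.repr (Q (V v)) i • b i : W) : SchreierSpace 𝕜 N) := by
        rw [b.sum_repr]
        rfl
      rw [h1, Submodule.coe_sum]
      refine norm_sum_le_of_le _ fun i _ => ?_
      rw [Submodule.coe_smul, norm_smul]
      rfl
    have hlim : Tendsto (fun k : ℕ => (∑ i, ‖f i‖ * ‖(b i : SchreierSpace 𝕜 N)‖) *
        (1 / 2) ^ (k + 1)) L (𝓝 0) := by
      simpa using (tendsto_half_pow_of_le_atTop hL).const_mul
        (∑ i, ‖f i‖ * ‖(b i : SchreierSpace 𝕜 N)‖)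
    refine squeeze_zero (fun k => ?_) (fun k => ?_) hlim
    · exact Finset.sum_nonneg fun n _ => mul_nonneg ((hx.average k).nonneg n) (norm_nonneg _)
    · calc _ ≤ ∑ n ∈ (x k).support, x k n * ∑ i, ‖f i (basis 𝕜 N n)‖ *
            ‖(b i : SchreierSpace 𝕜 N)‖ := Finset.sum_le_sum fun n _ =>
              mul_le_mul_of_nonneg_left (hf _) ((hx.average k).nonneg n)
        _ = ∑ i, (∑ n ∈ (x k).support, x k n * ‖f i (basis 𝕜 N n)‖) *
            ‖(b i : SchreierSpace 𝕜 N)‖ := by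
            simp only [Finset.mul_sum, Finset.sum_mul]
            rw [Finset.sum_comm]
            simp only [mul_assoc]
        _ ≤ ∑ i, (‖f i‖ * (1 / 2) ^ (k + 1)) * ‖(b i : SchreierSpace 𝕜 N)‖ :=
            Finset.sum_le_sum fun i _ =>
              mul_le_mul_of_nonneg_right (hx.sum_mul_norm_le k (f i)) (norm_nonneg _)
        _ = _ := by
            rw [Finset.sum_mul]
            exact Finset.sum_congr rfl fun i _ => by ring
  comp_mem_left S R hR V := by
    have h := (hR V).const_mul ‖S‖
    rw [mul_zero] at h
    refine squeeze_zero (fun k => ?_) (fun k => ?_) h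
    · exact Finset.sum_nonneg fun n _ => mul_nonneg ((hx.average k).nonneg n) (norm_nonneg _)
    · rw [Finset.mul_sum]
      refine Finset.sum_le_sum fun n _ => ?_
      calc _ ≤ x k n * (‖S‖ * ‖R (V (basis 𝕜 N n))‖) :=
            mul_le_mul_of_nonneg_left (S.le_opNorm _) ((hx.average k).nonneg n)
        _ = _ := by ring
  comp_mem_right S R hR V := hR (S ∘L V)
  isClosed := by
    refine isClosed_of_closure_subset fun R hR V => ?_
    rw [Metric.tendsto_nhds]
    intro ε hε
    have hV : 0 < ‖V‖ + 1 := by positivity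
    obtain ⟨R', hR', hd⟩ := Metric.mem_closure_iff.mp hR (ε / 2 / (‖V‖ + 1)) (by positivity)
    rw [dist_eq_norm] at hd
    filter_upwards [Metric.tendsto_nhds.mp (hR' V) (ε / 2) (half_pos hε)] with k hk
    have hnn : ∀ S : SchreierSpace 𝕜 N →L[𝕜] SchreierSpace 𝕜 N,
        0 ≤ ∑ n ∈ (x k).support, x k n * ‖S (V (basis 𝕜 N n))‖ := fun S =>
      Finset.sum_nonneg fun n _ => mul_nonneg ((hx.average k).nonneg n) (norm_nonneg _)
    rw [Real.dist_0_eq_abs, abs_of_nonneg (hnn _)] at hk ⊢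
    have h1 : ∀ n, ‖R (V (basis 𝕜 N n))‖ ≤ ‖R' (V (basis 𝕜 N n))‖ + ε / 2 := by
      intro n
      have h2 : ‖(R - R') (V (basis 𝕜 N n))‖ ≤ ε / 2 / (‖V‖ + 1) * (‖V‖ + 1) := by
        refine ((R - R').le_opNorm _).trans (mul_le_mul hd.le ?_ (norm_nonneg _) (by positivity))
        have := V.le_opNorm (basis 𝕜 N n)
        rw [norm_basis, mul_one] at this
        linarith
      rw [div_mul_cancel₀ _ hV.ne', sub_apply] at h2
      linarith [norm_le_insert' (R (V (basis 𝕜 N n))) (R' (V (basis 𝕜 N n)))]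
    calc _ ≤ ∑ n ∈ (x k).support, x k n * (‖R' (V (basis 𝕜 N n))‖ + ε / 2) :=
          Finset.sum_le_sum fun n _ => mul_le_mul_of_nonneg_left (h1 n) ((hx.average k).nonneg n)
      _ = ∑ n ∈ (x k).support, x k n * ‖R' (V (basis 𝕜 N n))‖ + ε / 2 := by
          simp only [mul_add, Finset.sum_add_distrib]
          rw [← Finset.sum_mul, (hx.average k).sum_eq, one_mul]
      _ < ε := by linarith

/-- Let `R` be bounded by the supremum over coordinates in a set `J` which eventually avoids the
interval `(p k, p (k + 1)]` that contains the support of `x k`. For `n` in this support choose a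
coordinate `j_n ∈ J` at which `V ẽ_n` is almost largest. After a choice of signs, the sum of the
moduli of these coordinates is at most the `ℓ₁`-norm over all `j_n` of `V` applied to a vector whose
norm is at most that of `x k`. Now there are at most `p k` of the `j_n` below `p k`, and those above
`p (k + 1)` form a set in `S_1`, so this `ℓ₁`-norm is at most `p k + 1` times the norm. -/
theorem IsSupBounded.mem_averageNullOperators (hN : 1 ≤ N) (hx : IsRapid N p x) {L : Filter ℕ}
    (hL : L ≤ atTop) {R : SchreierSpace 𝕜 N →L[𝕜] SchreierSpace 𝕜 N} {J : Set ℕ+} {C : ℝ}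
    (hC : 0 < C) (h : IsSupBounded R J C)
    (hJ : ∀ᶠ k in L, ∀ j ∈ J, (j : ℕ) ≤ p k ∨ p (k + 1) < (j : ℕ)) :
    R ∈ averageNullOperators hx L := by
  classical
  intro V
  have hlim : Tendsto (fun k : ℕ => (2 * C * ‖V‖ + 1) * (1 / 2) ^ (k + 1)) L (𝓝 0) := by
    simpa using (tendsto_half_pow_of_le_atTop hL).const_mul (2 * C * ‖V‖ + 1)
  refine squeeze_zero' (Eventually.of_forall fun k => ?_) ?_ hlim
  · exact Finset.sum_nonneg fun n _ => mul_nonneg ((hx.average k).nonneg n) (norm_nonneg _)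
  filter_upwards [hJ] with k hk
  choose φ hφJ hφ using fun n : ℕ+ =>
    h.exists_coord hC (V (basis 𝕜 N n)) (ε := (1 / 2) ^ (k + 1)) (by positivity)
  obtain ⟨c, hc, hsum⟩ := exists_coeff_sum_norm_le (x k).support φ
    fun n j => (x k n : 𝕜) * coord 𝕜 N j (V (basis 𝕜 N n))
  set u := ∑ n ∈ (x k).support, (c n * (x k n : 𝕜)) • basis 𝕜 N n with hu
  have hun : ‖u‖ ≤ (1 / 2) ^ (k + 1) / p k := hx.norm_sum_le k hc
  have hcoord : ∀ j, coord 𝕜 N j (V u) =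
      ∑ n ∈ (x k).support, c n * ((x k n : 𝕜) * coord 𝕜 N j (V (basis 𝕜 N n))) := by
    intro j
    rw [hu, map_sum, map_sum]
    refine Finset.sum_congr rfl fun n _ => ?_
    rw [map_smul, map_smul, smul_eq_mul, mul_assoc]
  simp only [← hcoord] at hsum
  have hp : (1 : ℝ) ≤ p k := by exact_mod_cast hx.one_le k
  set F := (x k).support.image φ with hF
  have hcard : ∀ (G : Finset ℕ+) (m : ℕ), (∀ n ∈ G, (n : ℕ) ≤ m) → G.card ≤ m := by
    intro G m hG
    rw [← Finset.card_image_of_injective G PNat.coe_injective]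
    calc _ ≤ (Finset.Icc 1 m).card := Finset.card_le_card fun i hi => by
          obtain ⟨n, hn, rfl⟩ := Finset.mem_image.mp hi
          exact Finset.mem_Icc.mpr ⟨n.2, hG n hn⟩
      _ = m := by simp
  have hlow : ∑ j ∈ F.filter fun j : ℕ+ => (j : ℕ) ≤ p k, ‖coord 𝕜 N j (V u)‖ ≤ p k * ‖V u‖ := by
    refine (Finset.sum_le_card_nsmul _ _ _ fun j _ => norm_coord_le (V u) j).trans ?_
    rw [nsmul_eq_mul]
    gcongr
    exact hcard _ _ fun n hn => (Finset.mem_filter.mp hn).2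
  have hhigh : ∑ j ∈ F.filter fun j : ℕ+ => ¬ (j : ℕ) ≤ p k, ‖coord 𝕜 N j (V u)‖ ≤ ‖V u‖ := by
    refine sum_norm_coord_le _ ?_
    obtain ⟨M, rfl⟩ := Nat.exists_eq_add_of_le' hN
    refine mem_schreierFamily_of_card_le M fun j hj => ?_
    rw [Finset.mem_filter] at hj
    obtain ⟨n, -, rfl⟩ := Finset.mem_image.mp hj.1
    have h1 : F.card ≤ p (k + 1) := Finset.card_image_le.trans (hcard _ _ (hx.le k))
    have h2 := Finset.card_filter_le F fun j : ℕ+ => ¬ (j : ℕ) ≤ p k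
    have h3 := (hk _ (hφJ n)).resolve_left hj.2
    lia
  have htotal : ∑ n ∈ (x k).support, x k n * ‖coord 𝕜 N (φ n) (V (basis 𝕜 N n))‖ ≤
      2 * ‖V‖ * (1 / 2) ^ (k + 1) := by
    calc _ = ∑ n ∈ (x k).support, ‖(x k n : 𝕜) * coord 𝕜 N (φ n) (V (basis 𝕜 N n))‖ :=
          Finset.sum_congr rfl fun n _ => by
            rw [norm_mul, RCLike.norm_ofReal, abs_of_nonneg ((hx.average k).nonneg n)]
      _ ≤ ∑ j ∈ F, ‖coord 𝕜 N j (V u)‖ := hsum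
      _ ≤ (p k + 1) * ‖V u‖ := by
          rw [← Finset.sum_filter_add_sum_filter_not F fun j : ℕ+ => (j : ℕ) ≤ p k]
          linarith
      _ ≤ (2 * p k) * (‖V‖ * ((1 / 2) ^ (k + 1) / p k)) := by
          gcongr
          · linarith
          · exact (V.le_opNorm u).trans (by gcongr)
      _ = 2 * ‖V‖ * (1 / 2) ^ (k + 1) := by
          have : (p k : ℝ) ≠ 0 := by positivity
          field_simp
  calc _ ≤ ∑ n ∈ (x k).support,
        x k n * (C * ‖coord 𝕜 N (φ n) (V (basis 𝕜 N n))‖ + (1 / 2) ^ (k + 1)) :=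
        Finset.sum_le_sum fun n _ =>
          mul_le_mul_of_nonneg_left (hφ n) ((hx.average k).nonneg n)
    _ = C * ∑ n ∈ (x k).support, x k n * ‖coord 𝕜 N (φ n) (V (basis 𝕜 N n))‖ +
        (1 / 2) ^ (k + 1) := by
        simp only [mul_add, Finset.sum_add_distrib]
        rw [← Finset.sum_mul, (hx.average k).sum_eq, one_mul, Finset.mul_sum]
        congr 1
        exact Finset.sum_congr rfl fun n _ => by ring
    _ ≤ C * (2 * ‖V‖ * (1 / 2) ^ (k + 1)) + (1 / 2) ^ (k + 1) := by gcongr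
    _ = _ := by ring

theorem notMem_averageNullOperators (hx : IsRapid N p x) {L : Filter ℕ} [L.NeBot]
    {R : SchreierSpace 𝕜 N →L[𝕜] SchreierSpace 𝕜 N}
    (h : ∀ᶠ k in L, ∀ n ∈ (x k).support, ‖R (basis 𝕜 N n)‖ = 1) :
    R ∉ averageNullOperators hx L := fun hR => by
  have h1 := hR (ContinuousLinearMap.id 𝕜 _)
  refine zero_ne_one (tendsto_nhds_unique (h1.congr' ?_) tendsto_const_nhds)
  filter_upwards [h] with k hk
  rw [← (hx.average k).sum_eq]
  exact Finset.sum_congr rfl fun n hn => by simp [hk n hn]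

end SchreierSpace

/-! ### An almost disjoint family indexed by the reals -/

/-- The codes of the pairs `(m, ⌊m r⌋)`. For `r ≠ s` the integers `⌊m r⌋` and `⌊m s⌋` differ for all
large `m`, so these sets form an almost disjoint family. -/
def floorCodes (r : ℝ) : Set ℕ :=
  Set.range fun m : ℕ => Encodable.encode (m, ⌊(m : ℝ) * r⌋)

theorem infinite_floorCodes (r : ℝ) : (floorCodes r).Infinite :=
  Set.infinite_range_of_injective fun _ _ h =>
    congrArg Prod.fst (Encodable.encode_injective h)

theorem finite_floorCodes_inter {r s : ℝ} (h : r ≠ s) : (floorCodes r ∩ floorCodes s).Finite := by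
  obtain ⟨K, hK⟩ := exists_nat_gt (1 / |r - s|)
  have hrs : 0 < |r - s| := abs_pos.mpr (sub_ne_zero.mpr h)
  refine ((Set.finite_Iio K).image fun m : ℕ => Encodable.encode (m, ⌊(m : ℝ) * r⌋)).subset ?_
  rintro _ ⟨⟨m, rfl⟩, ⟨l, hl⟩⟩
  refine ⟨m, ?_, rfl⟩
  have h1 := Encodable.encode_injective hl
  rw [Prod.mk.injEq] at h1
  obtain ⟨rfl, h2⟩ := h1
  have h3 := Int.abs_sub_lt_one_of_floor_eq_floor h2
  rw [← mul_sub, abs_mul, abs_sub_comm, Nat.abs_cast, ← lt_div_iff₀ hrs] at h3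
  exact_mod_cast h3.trans hK

/-! ### Order-embedded copies of the power set of the reals -/

section PowerSet

universe u

theorem mk_range_of_injective {α : Type u} {β : Type} {f : β → α} (hf : Function.Injective f) :
    #(Set.range f) = Cardinal.lift.{u} #β := by
  simpa using Cardinal.mk_range_eq_of_injective hf

variable {α : Type u} [PartialOrder α] {Φ : Set ℝ → α}

theorem injective_of_le_iff_subset (hΦ : ∀ A B, Φ A ≤ Φ B ↔ A ⊆ B) : Function.Injective Φ :=
  fun A B h => ((hΦ A B).mp h.le).antisymm ((hΦ B A).mp h.ge)

theorem exists_chain_of_le_iff_subset (hΦ : ∀ A B, Φ A ≤ Φ B ↔ A ⊆ B) :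
    ∃ C ⊆ Set.range Φ, IsChain (· ≤ ·) C ∧ #C = 𝔠 := by
  refine ⟨Set.range fun t : ℝ => Φ (Set.Iic t), ?_, ?_, ?_⟩
  · rintro _ ⟨t, rfl⟩
    exact ⟨_, rfl⟩
  · rintro _ ⟨s, rfl⟩ _ ⟨t, rfl⟩ -
    simp only [hΦ, Set.Iic_subset_Iic]
    exact le_total s t
  · rw [mk_range_of_injective fun s t h =>
      Set.Iic_injective (injective_of_le_iff_subset hΦ h), Cardinal.mk_real, Cardinal.lift_continuum]

/-- Splitting `ℝ` into two copies of `ℝ`, the sets `A ⊔ Aᶜ` form an antichain. -/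
theorem exists_antichain_of_le_iff_subset (hΦ : ∀ A B, Φ A ≤ Φ B ↔ A ⊆ B) :
    ∃ D ⊆ Set.range Φ, IsAntichain (· ≤ ·) D ∧ #D = 2 ^ 𝔠 := by
  obtain ⟨e⟩ : Nonempty (ℝ ≃ ℝ ⊕ ℝ) := Cardinal.eq.mp (by simp)
  let Ψ : Set ℝ → Set ℝ := fun A => e ⁻¹' (Sum.inl '' A ∪ Sum.inr '' Aᶜ)
  have hΨ : ∀ A B, Ψ A ⊆ Ψ B → A = B := by
    intro A B h
    refine Set.Subset.antisymm (fun t ht => ?_) fun t ht => ?_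
    · simpa [Ψ, ht] using @h (e.symm (Sum.inl t))
    · by_contra htA
      simpa [Ψ, htA, ht] using @h (e.symm (Sum.inr t))
  refine ⟨Set.range fun A => Φ (Ψ A), ?_, ?_, ?_⟩
  · rintro _ ⟨t, rfl⟩
    exact ⟨_, rfl⟩
  · rintro _ ⟨A, rfl⟩ _ ⟨B, rfl⟩ hAB h
    exact hAB (by rw [hΨ A B ((hΦ _ _).mp h)])
  · rw [mk_range_of_injective fun A B h =>
      hΨ A B (injective_of_le_iff_subset hΦ h).subset, Cardinal.mk_set, Cardinal.mk_real,
      Cardinal.lift_two_power, Cardinal.lift_continuum]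

theorem two_power_continuum_le_mk (hΦ : ∀ A B, Φ A ≤ Φ B ↔ A ⊆ B) (S : Set α)
    (hS : ∀ A, Φ A ∈ S) : 2 ^ 𝔠 ≤ #S := by
  have h : #(Set.range Φ) = 2 ^ 𝔠 := by
    rw [mk_range_of_injective (injective_of_le_iff_subset hΦ), Cardinal.mk_set, Cardinal.mk_real,
      Cardinal.lift_two_power, Cardinal.lift_continuum]
  rw [← h]
  exact Cardinal.mk_le_mk_of_subset (Set.range_subset_iff.mpr hS)

end PowerSet

/-! ### The ideals generated by the operators `T P_{J_r}` -/

theorem RCLike.mk_le_continuum (𝕜 : Type*) [RCLike 𝕜] : #𝕜 ≤ 𝔠 := by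
  have h : Function.Injective fun z : 𝕜 => (RCLike.re z, RCLike.im z) := fun z w h =>
    RCLike.ext (congrArg Prod.fst h) (congrArg Prod.snd h)
  have h1 := Cardinal.lift_mk_le_lift_mk_of_injective h
  simpa [Cardinal.mk_real, Cardinal.lift_continuum] using h1

namespace SchreierSpace

open Filter Topology

variable {𝕜 : Type*} [RCLike 𝕜] {N : ℕ}

theorem ext_coord {x y : SchreierSpace 𝕜 N} (h : ∀ n, coord 𝕜 N n x = coord 𝕜 N n y) : x = y := by
  rw [← sub_eq_zero, ← norm_le_zero_iff]
  exact norm_le_of_coord _ fun F _ => by simp [h]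

theorem operator_ext {S T : SchreierSpace 𝕜 N →L[𝕜] SchreierSpace 𝕜 N}
    (h : ∀ n, S (basis 𝕜 N n) = T (basis 𝕜 N n)) : S = T := by
  ext x
  induction x using UniformSpace.Completion.induction_on with
  | hp => exact isClosed_eq S.continuous T.continuous
  | ih y =>
    obtain ⟨a, rfl⟩ := (SchreierCore.ofFinsupp (𝕜 := 𝕜) (N := N)).surjective y
    simp [coe_ofFinsupp, Finsupp.sum, map_sum, h]

theorem mk_operators_le_continuum :
    #(SchreierSpace 𝕜 N →L[𝕜] SchreierSpace 𝕜 N) ≤ 𝔠 := by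
  have hinj : Function.Injective fun (S : SchreierSpace 𝕜 N →L[𝕜] SchreierSpace 𝕜 N)
      (q : ℕ+ × ℕ+) => coord 𝕜 N q.2 (S (basis 𝕜 N q.1)) := fun S T h =>
    operator_ext fun n => ext_coord fun m => congrFun h (n, m)
  calc _ ≤ #(ℕ+ × ℕ+ → 𝕜) := Cardinal.mk_le_of_injective hinj
    _ = #𝕜 ^ Cardinal.aleph0 := by simp
    _ ≤ 𝔠 ^ Cardinal.aleph0 := Cardinal.power_le_power_right (RCLike.mk_le_continuum 𝕜)
    _ = 𝔠 := Cardinal.continuum_power_aleph0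

theorem mk_smallClosedIdeals_le :
    #{I : Submodule 𝕜 (SchreierSpace 𝕜 N →L[𝕜] SchreierSpace 𝕜 N) // IsSmallClosedIdeal I}
      ≤ 2 ^ 𝔠 := by
  calc _ ≤ #(Set (SchreierSpace 𝕜 N →L[𝕜] SchreierSpace 𝕜 N)) :=
        Cardinal.mk_le_of_injective (f := fun I => (I.1 : Set _))
          (SetLike.coe_injective.comp Subtype.val_injective)
    _ = 2 ^ #(SchreierSpace 𝕜 N →L[𝕜] SchreierSpace 𝕜 N) := Cardinal.mk_set
    _ ≤ 2 ^ 𝔠 := Cardinal.power_le_power_left two_ne_zero mk_operators_le_continuum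

/-- The index sets `J_r`: the unions of the supports of the averages `x k` over the members `k` of
an almost disjoint family. -/
def blockUnion (x : ℕ → ℕ+ →₀ ℝ) (r : ℝ) : Set ℕ+ :=
  {n | ∃ k ∈ floorCodes r, n ∈ (x k).support}

theorem _root_.IsRapid.eq_of_mem {p : ℕ → ℕ} {x : ℕ → ℕ+ →₀ ℝ} (hx : IsRapid N p x) {k l : ℕ}
    {n : ℕ+} (hl : n ∈ (x l).support) (h1 : p k < n) (h2 : (n : ℕ) ≤ p (k + 1)) : l = k := by
  have h3 := (hx.average l).lt n hl
  have h4 := hx.le l n hl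
  by_contra hlk
  rcases lt_or_gt_of_ne hlk with h | h
  · have : p (l + 1) ≤ p k := hx.mono h
    lia
  · have : p (k + 1) ≤ p l := hx.mono h
    lia

theorem infinite_blockUnion {p : ℕ → ℕ} {x : ℕ → ℕ+ →₀ ℝ} (hx : IsRapid N p x) (r : ℝ) :
    (blockUnion x r).Infinite := by
  choose n hn using fun k => (hx.average k).support_nonempty
  have hinj : Function.Injective n := fun k l h =>
    (hx.eq_of_mem (hn l) (h ▸ (hx.average k).lt _ (hn k)) (h ▸ hx.le k _ (hn k))).symm
  refine ((infinite_floorCodes r).image hinj.injOn).mono ?_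
  rintro _ ⟨k, hk, rfl⟩
  exact ⟨k, hk, hn k⟩

/-- `T P_{J_r}` lies in the closed ideal generated by the `T P_{J_s}`, `s ∈ B`, only if `r ∈ B`: the
operators whose averages along the blocks of `J_r` tend to `0` form a closed ideal, which contains
the `T P_{J_s}` with `s ≠ r`, but not `T P_{J_r}`. -/
theorem mem_of_mem_closedIdealSpan {p : ℕ → ℕ} {x : ℕ → ℕ+ →₀ ℝ} (hN : 1 ≤ N)
    (hx : IsRapid N p x) {T : SchreierSpace 𝕜 N →L[𝕜] SchreierSpace 𝕜 N} {C : ℝ} (hC : 0 < C)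
    (hT : ∀ n, ‖T (basis 𝕜 N n)‖ = 1)
    (hTJ : ∀ J : Set ℕ+, J.Nonempty → IsSupBounded (T ∘L proj 𝕜 N J) J C) {r : ℝ} {B : Set ℝ}
    (h : T ∘L proj 𝕜 N (blockUnion x r) ∈
      closedIdealSpan ((fun s => T ∘L proj 𝕜 N (blockUnion x s)) '' B)) : r ∈ B := by
  by_contra hr
  let L : Filter ℕ := atTop ⊓ 𝓟 (floorCodes r)
  have hLr : ∀ᶠ k in L, k ∈ floorCodes r := mem_inf_of_right (mem_principal_self _)
  have : L.NeBot := frequently_mem_iff_neBot.mp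
    (Nat.frequently_atTop_iff_infinite.mpr (infinite_floorCodes r))
  refine notMem_averageNullOperators hx (L := L) (R := T ∘L proj 𝕜 N (blockUnion x r)) ?_
    (closedIdealSpan_le (isClosedOperatorIdeal_averageNullOperators hx inf_le_left) ?_ h)
  · filter_upwards [hLr] with k hk n hn
    rw [ContinuousLinearMap.comp_apply, proj_basis, if_pos ⟨k, hk, hn⟩, hT]
  · rintro _ ⟨s, hs, rfl⟩
    refine (hTJ _ (infinite_blockUnion hx s).nonempty).mem_averageNullOperators hN hx inf_le_left
      hC ?_
    have hfin : ∀ᶠ k in L, k ∉ floorCodes r ∩ floorCodes s :=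
      (inf_le_left : L ≤ atTop) ((Nat.cofinite_eq_atTop) ▸
        (finite_floorCodes_inter fun h : r = s => hr (h ▸ hs)).eventually_cofinite_notMem)
    filter_upwards [hLr, hfin] with k hk hks n hn
    obtain ⟨l, hl, hnl⟩ := hn
    by_contra! hcon
    obtain rfl := hx.eq_of_mem hnl hcon.1 hcon.2
    exact hks ⟨hk, hl⟩

end SchreierSpace

theorem theorem4 (𝕜 : Type*) [RCLike 𝕜] (N : ℕ) (hN : 1 ≤ N) :
    -- the family of ideals, with its generators
    (∃ e : ℕ+ → SchreierSpace 𝕜 N, IsNormalizedC0Sequence 𝕜 e) ∧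
    (∃ J : ℝ → Set ℕ+, (∀ r, (J r).Infinite) ∧
      ∀ e : ℕ+ → SchreierSpace 𝕜 N, IsNormalizedC0Sequence 𝕜 e →
        ∃ T : SchreierSpace 𝕜 N →L[𝕜] SchreierSpace 𝕜 N,
          (∀ n, T (SchreierSpace.basis 𝕜 N n) = e n) ∧
          ∃ I : Set ℝ → Submodule 𝕜 (SchreierSpace 𝕜 N →L[𝕜] SchreierSpace 𝕜 N),
            (∀ A, I A =
              closedIdealSpan ((fun r => T ∘L SchreierSpace.proj 𝕜 N (J r)) '' A)) ∧
            (∀ A, IsSmallClosedIdeal (I A)) ∧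
            ∀ A B, I A ≤ I B ↔ A ⊆ B) ∧
    -- the number of small closed ideals
    #{I : Submodule 𝕜 (SchreierSpace 𝕜 N →L[𝕜] SchreierSpace 𝕜 N) // IsSmallClosedIdeal I}
      = 2 ^ 𝔠 ∧
    -- a chain
    (∃ C : Set (Submodule 𝕜 (SchreierSpace 𝕜 N →L[𝕜] SchreierSpace 𝕜 N)),
      (∀ I ∈ C, IsSmallClosedIdeal I) ∧ IsChain (· ≤ ·) C ∧ #C = 𝔠) ∧
    -- an antichain
    (∃ D : Set (Submodule 𝕜 (SchreierSpace 𝕜 N →L[𝕜] SchreierSpace 𝕜 N)),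
      (∀ I ∈ D, IsSmallClosedIdeal I) ∧ IsAntichain (· ≤ ·) D ∧ #D = 2 ^ 𝔠) := by
  obtain ⟨p, x, hx⟩ := exists_isRapid N
  have main : ∀ e : ℕ+ → SchreierSpace 𝕜 N, IsNormalizedC0Sequence 𝕜 e →
      ∃ T : SchreierSpace 𝕜 N →L[𝕜] SchreierSpace 𝕜 N,
        (∀ n, T (SchreierSpace.basis 𝕜 N n) = e n) ∧
        ∃ I : Set ℝ → Submodule 𝕜 (SchreierSpace 𝕜 N →L[𝕜] SchreierSpace 𝕜 N),
          (∀ A, I A = closedIdealSpan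
            ((fun r => T ∘L SchreierSpace.proj 𝕜 N (SchreierSpace.blockUnion x r)) '' A)) ∧
          (∀ A, IsSmallClosedIdeal (I A)) ∧ ∀ A B, I A ≤ I B ↔ A ⊆ B := by
    intro e he
    obtain ⟨T, C, hC, hTe, hTJ⟩ := SchreierSpace.exists_operator_of_c0 he
    have hsmall := isSmallClosedIdeal_hereditarilySmallOperators (𝕜 := 𝕜) (X := SchreierSpace 𝕜 N)
    refine ⟨T, hTe, _, fun A => rfl, fun A =>
      ⟨isClosedOperatorIdeal_closedIdealSpan _, fun R hR => hsmall.strictlySingular R ?_⟩,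
      fun A B => ⟨fun h r hr => ?_, fun h => closedIdealSpan_mono (Set.image_mono h)⟩⟩
    · refine closedIdealSpan_le hsmall.toIsClosedOperatorIdeal ?_ hR
      rintro _ ⟨r, -, rfl⟩
      exact (hTJ _ (SchreierSpace.infinite_blockUnion hx r).nonempty).mem_hereditarilySmallOperators
        hN hC
    · refine SchreierSpace.mem_of_mem_closedIdealSpan hN hx hC (fun n => ?_) hTJ
        (h (subset_closedIdealSpan _ ⟨r, hr, rfl⟩))
      rw [hTe, he.1]
  obtain ⟨e, he⟩ := SchreierSpace.exists_isNormalizedC0Sequence (𝕜 := 𝕜) hN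
  obtain ⟨T, -, I, -, hI, hle⟩ := main e he
  refine ⟨⟨e, he⟩, ⟨_, SchreierSpace.infinite_blockUnion hx, main⟩,
    SchreierSpace.mk_smallClosedIdeals_le.antisymm
      (two_power_continuum_le_mk hle {I | IsSmallClosedIdeal I} hI), ?_, ?_⟩
  · obtain ⟨C, hC, h⟩ := exists_chain_of_le_iff_subset hle
    exact ⟨C, fun J hJ => by obtain ⟨A, rfl⟩ := hC hJ; exact hI A, h⟩
  · obtain ⟨D, hD, h⟩ := exists_antichain_of_le_iff_subset hle
    exact ⟨D, fun J hJ => by obtain ⟨A, rfl⟩ := hD hJ; exact hI A, h⟩
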